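/- Let $F$ be a number field with algebraic closure $\overline F$, and let $(V,\psi)$ be a finite-dimensional rational polarized pure Hodge structure of odd weight $n$. Write $V_R=V\otimes_{\mathbb Q}R$, and let $\mathrm{Iso}_{(V,\psi)}\subset \mathrm{GIso}_{(V,\psi)}\subset \mathrm{GL}_V$ be the group schemes over $\mathbb Q$ of isometries and of similitudes of $\psi$. For an algebraic group $G$, $G^\circ$ denotes its identity component; $G$ is called reductive if $G^\circ$ is reductive. The Mumford–Tate group $MT(V,\psi)$ is the smallest algebraic subgroup of $\mathrm{GIso}_{(V,\psi)}$ over $\mathbb Q$ whose complex points contain $\mu_\infty(\mathbb C^\times)$, where $\mu_\infty(z)$ acts on $V^{p,q}$ as $z^{-p}$. The Hodge group is $H(V,\psi)=(MT(V,\psi)\cap \mathrm{Iso}_{(V,\psi)})^\circ$. Let $D\subset \mathrm{End}_{\mathbb Q}(V)$ be a $\mathbb Q$-subalgebra preserving the Hodge decomposition of $V_{\mathbb C}$, with a continuous action $\rho_e$ of $G_F=\mathrm{Gal}(\overline F/F)$ by $\mathbb Q$-algebra automorphisms ($D$ discrete, $\ker\rho_e$ open). The Lefschetz group is $L(V,\psi,D)=C_D(\mathrm{Iso}_{(V,\psi)})^\circ$,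 where $C_D$ denotes the centralizer of $D$. For a finite extension $K/F$ inside $\overline F$ put $G_K=\mathrm{Gal}(\overline F/K)$, let $K_e$ be the fixed field of $\ker(\rho_e|_{G_K})$, and let $$DL_K(V,\psi,D)=\bigsqcup_{\tau\in \mathrm{Gal}(K_e/K)}\{g\in \mathrm{Iso}_{(V,\psi)}:\ g\beta g^{-1}=\rho_e(\tau)(\beta)\ \ \forall \beta\in D\}.$$ For every prime $l$ let $\rho_l:G_F\to \mathrm{GL}(V_{\mathbb Q_l})$ be a continuous representation such that $\psi_l:V_{\mathbb Q_l}\times V_{\mathbb Q_l}\to\mathbb Q_l(-n)$ is $G_F$-equivariant, i.e. $\psi_l(\rho_l(\sigma)v,\rho_l(\sigma)w)=\chi_c(\sigma)^{-n}\psi_l(v,w)$ with $\chi_c$ the $l$-adic cyclotomic character, and such that $\rho_l(\sigma)(\beta v)=\rho_e(\sigma)(\beta)\,\rho_l(\sigma)(v)$ for all $\sigma\in G_F$, $\beta\in D$, $v\in V_{\mathbb Q_l}$. (No further condition on the family $(\rho_l)$, such as being of Hodge–Tate type or strictly compatible, is imposed.) Let $G^{alg}_{l,K}$ be the Zariski closure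 of $\rho_l(G_K)$ and $G^{alg}_{l,K,1}=G^{alg}_{l,K}\cap \mathrm{Iso}_{(V_{\mathbb Q_l},\psi_l)}$. Theorem. Let $K/F$ be a finite extension inside $\overline F$. Assume that 1. $H(V,\psi)=L(V,\psi,D)=DL_{K_e}(V,\psi,D)$; 2. $(G^{alg}_{l,K})^\circ=MT(V,\psi)_{\mathbb Q_l}$ for every prime $l$. Then $G^{alg}_{l,K,1}=DL_K(V,\psi,D)_{\mathbb Q_l}$ for every prime $l$. Consequently the algebraic Sato–Tate conjecture holds for $(V,\psi)$ with $AST_{K'}(V,\psi)=DL_{K'}(V,\psi,D)$ for all finite extensions $K'/F$ inside $\overline F$. That is: the $DL_{K'}(V,\psi,D)$ are reductive algebraic subgroups of $\mathrm{Iso}_{(V,\psi)}$ over $\mathbb Q$; $DL_{L}(V,\psi,D)\subset DL_{K'}(V,\psi,D)$ whenever $K'\subset L$; and for every prime $l$ there are isomorphisms of group schemes $G^{alg}_{l,K',1}\cong DL_{K'}(V,\psi,D)_{\mathbb Q_l}$ over $\mathbb Q_l$ that are compatible with the inclusions for $K'\subset L$. -/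

import Mathlib

open scoped MatrixGroups

noncomputable section

/-! ### Closed subschemes and algebraic subgroups of `GL_d`, through their points

Throughout `k` is a field and `V = k ^ d`, so that `GL_V(R)` is the group `GL (Fin d) R` for every
commutative `k`-algebra `R`. -/

/-- A subset of the points of the functor `GL_d` on commutative `k`-algebras. -/
abbrev SubGL (k : Type) [Field k] (d : ℕ) : Type 1 :=
  ∀ (R : Type) [CommRing R] [Algebra k R], Set (GL (Fin d) R)

/-- Every regular function on `GL_d` is a polynomial in the entries of `g` (the variables
`(true, i, j)`) and the entries of `g⁻¹` (the variables `(false, i, j)`). -/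
abbrev CoordPoly (k : Type) [Field k] (d : ℕ) : Type :=
  MvPolynomial (Bool × Fin d × Fin d) k

/-- The value `f(g)` of a regular function `f` at an `R`-point `g` of `GL_d`. -/
def regEval {k : Type} [Field k] {d : ℕ} {R : Type} [CommRing R] [Algebra k R]
    (g : GL (Fin d) R) (f : CoordPoly k d) : R :=
  MvPolynomial.aeval
    (fun x : Bool × Fin d × Fin d =>
      bif x.1 then (g : Matrix (Fin d) (Fin d) R) x.2.1 x.2.2
      else ((g⁻¹ : GL (Fin d) R) : Matrix (Fin d) (Fin d) R) x.2.1 x.2.2) f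

namespace SubGL

variable {k : Type} [Field k] {d : ℕ}

/-- Containment. -/
def Contained (X Y : SubGL k d) : Prop :=
  ∀ (R : Type) [CommRing R] [Algebra k R], X R ⊆ Y R

/-- Intersection (fibre product inside `GL_d`). -/
def inter (X Y : SubGL k d) : SubGL k d := fun R _ _ => X R ∩ Y R

/-- The regular function `f` vanishes on `X`. -/
def Vanishes (f : CoordPoly k d) (X : SubGL k d) : Prop :=
  ∀ (R : Type) [CommRing R] [Algebra k R], ∀ g ∈ X R, regEval g f = 0

/-- The closed subscheme of `GL_d` cut out by a set of equations. -/
def zeroLocus (S : Set (CoordPoly k d)) : SubGL k d :=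
  fun R _ _ => {g : GL (Fin d) R | ∀ f ∈ S, regEval g f = 0}

/-- `X` is a closed subgroup scheme of `GL_d` over `k`. -/
structure IsAlgSubgroup (X : SubGL k d) : Prop where
  closed : ∃ S : Set (CoordPoly k d), X = zeroLocus S
  one_mem : ∀ (R : Type) [CommRing R] [Algebra k R], (1 : GL (Fin d) R) ∈ X R
  mul_mem : ∀ (R : Type) [CommRing R] [Algebra k R], ∀ g ∈ X R, ∀ h ∈ X R, g * h ∈ X R
  inv_mem : ∀ (R : Type) [CommRing R] [Algebra k R], ∀ g ∈ X R, g⁻¹ ∈ X R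

/-- The Zariski closure over `k` of a set of `k`-points. -/
def zariskiClosure (S : Set (GL (Fin d) k)) : SubGL k d :=
  zeroLocus {f | ∀ g ∈ S, regEval g f = 0}

/-- The smallest closed subscheme containing all `X j`. For a finite family of pairwise disjoint
closed subschemes it is their disjoint union. -/
def union {J : Type*} (X : J → SubGL k d) : SubGL k d :=
  zeroLocus {f | ∀ j, Vanishes f (X j)}

/-- The smallest algebraic subgroup `X ⊆ A` over `k` such that `X(E)` contains the set `S` of
`E`-points. -/
def generated (A : SubGL k d) (E : Type) [CommRing E] [Algebra k E]
    (S : Set (GL (Fin d) E)) : SubGL k d :=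
  fun R _ _ => {g : GL (Fin d) R |
    ∀ X : SubGL k d, IsAlgSubgroup X → Contained X A → S ⊆ X E → g ∈ X R}

/-- The connected component `X°` of the identity of a closed subscheme `X ∋ 1`. The open and closed
subschemes of `X` containing the `k`-point `1` are the loci `e = 1`, where `e` is an idempotent
regular function on `X` with `e(1) = 1`; the component of `1` is the intersection of these
(finitely many, as `X` is noetherian) loci. -/
def idComp (X : SubGL k d) : SubGL k d :=
  fun R _ _ => {g : GL (Fin d) R | g ∈ X R ∧
    ∀ e : CoordPoly k d,
      (∀ (A : Type) [CommRing A] [Algebra k A], ∀ h ∈ X A, IsIdempotentElem (regEval h e)) →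
      regEval (1 : GL (Fin d) k) e = 1 → regEval g e = 1}

/-- Base change to an extension field `k'`: restriction of the functor to `k'`-algebras. -/
def baseChange (X : SubGL k d) (k' : Type) [Field k'] [Algebra k k'] : SubGL k' d :=
  fun R _ _ => @X R _ (Algebra.compHom R (algebraMap k k'))

/-- `G` is reductive: the unipotent radical of `G°` over an algebraic closure of `k` is trivial,
that is, a closed connected normal subgroup of `G°` over the algebraic closure that consists of
unipotent elements is trivial. (The identity component, not `G`, has to be reductive.) -/
def IsReductive (G : SubGL k d) : Prop :=
  ∀ U : Subgroup (GL (Fin d) (AlgebraicClosure k)),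
    (U : Set (GL (Fin d) (AlgebraicClosure k))) ⊆ idComp G (AlgebraicClosure k) →
    (U : Set (GL (Fin d) (AlgebraicClosure k))) =
      zariskiClosure (U : Set (GL (Fin d) (AlgebraicClosure k))) (AlgebraicClosure k) →
    idComp (zariskiClosure (U : Set (GL (Fin d) (AlgebraicClosure k)))) =
      zariskiClosure (U : Set (GL (Fin d) (AlgebraicClosure k))) →
    (∀ g ∈ idComp G (AlgebraicClosure k), ∀ u ∈ U, g * u * g⁻¹ ∈ U) →
    (∀ u ∈ U,
      IsNilpotent ((u : Matrix (Fin d) (Fin d) (AlgebraicClosure k)) - 1)) →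
    U = ⊥

/-- `φ` is an isomorphism of group schemes from `X` to `Y`. -/
structure IsGroupIso (X Y : SubGL k d)
    (φ : ∀ (R : Type) [CommRing R] [Algebra k R], GL (Fin d) R → GL (Fin d) R) : Prop where
  bijOn : ∀ (R : Type) [CommRing R] [Algebra k R], Set.BijOn (φ R) (X R) (Y R)
  map_mul : ∀ (R : Type) [CommRing R] [Algebra k R], ∀ g ∈ X R, ∀ h ∈ X R,
    φ R (g * h) = φ R g * φ R h
  natural : ∀ (R S : Type) [CommRing R] [Algebra k R] [CommRing S] [Algebra k S]
    (f : R →ₐ[k] S), ∀ g ∈ X R,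
    φ S (Matrix.GeneralLinearGroup.map (f : R →+* S) g) =
      Matrix.GeneralLinearGroup.map (f : R →+* S) (φ R g)

end SubGL

/-! ### Polarized Hodge structures, Mumford-Tate, Hodge and Lefschetz groups -/

/-- The base change `ψ_R` of the bilinear form on `V = ℚ ^ d` with Gram matrix `ψ`. -/
def formOn {d : ℕ} (ψ : Matrix (Fin d) (Fin d) ℚ) (R : Type) [CommRing R] [Algebra ℚ R]
    (v w : Fin d → R) : R :=
  v ⬝ᵥ (ψ.map (algebraMap ℚ R)).mulVec w

/-- A rational polarized pure Hodge structure of weight `n` on `V = ℚ ^ d`. -/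
structure PolarizedHodge (d : ℕ) (n : ℤ) where
  /-- `hdg p` is the subspace `V^{p, n - p}` of `V_ℂ`. -/
  hdg : ℤ → Submodule ℂ (Fin d → ℂ)
  isInternal : DirectSum.IsInternal hdg
  conj_mem : ∀ p, ∀ v ∈ hdg p, star v ∈ hdg (n - p)
  /-- The Gram matrix of the polarization `V × V → ℚ(-n)`. -/
  psi : Matrix (Fin d) (Fin d) ℚ
  nondegenerate : psi.det ≠ 0
  symm : psi.transpose = (-1 : ℚ) ^ n • psi
  orthogonal : ∀ p p', p + p' ≠ n → ∀ v ∈ hdg p, ∀ w ∈ hdg p', formOn psi ℂ v w = 0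
  /-- `i^{p - q} ψ(v, v̄)`, with `q = n - p`, is definite. Its sign depends on the normalization
  of the Weil operator and of the generator of `ℚ(-n)`; both signs are admitted. -/
  definite : ∃ s : ℤˣ, ∀ p, ∀ v ∈ hdg p, v ≠ 0 →
    0 < ((s : ℤ) : ℝ) * (Complex.I ^ (2 * p - n) * formOn psi ℂ v (star v)).re

namespace PolarizedHodge

variable {d : ℕ} {n : ℤ} (V : PolarizedHodge d n)

/-- The group of similitudes `GIso_{(V, ψ)}`. -/
def gIso : SubGL ℚ d := fun R _ _ => {g : GL (Fin d) R | ∃ c : Rˣ, ∀ v w : Fin d → R,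
  formOn V.psi R ((g : Matrix (Fin d) (Fin d) R).mulVec v)
    ((g : Matrix (Fin d) (Fin d) R).mulVec w) = c * formOn V.psi R v w}

/-- The group of isometries `Iso_{(V, ψ)}`. -/
def iso : SubGL ℚ d := fun R _ _ => {g : GL (Fin d) R | ∀ v w : Fin d → R,
  formOn V.psi R ((g : Matrix (Fin d) (Fin d) R).mulVec v)
    ((g : Matrix (Fin d) (Fin d) R).mulVec w) = formOn V.psi R v w}

/-- The image `μ_∞(ℂˣ)` of the cocharacter for which `μ_∞(z)` is multiplication by `z ^ (-p)` on
`V^{p,q}`. -/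
def muImage : Set (GL (Fin d) ℂ) := {g | ∃ z : ℂˣ, ∀ p, ∀ v ∈ V.hdg p,
  (g : Matrix (Fin d) (Fin d) ℂ).mulVec v = (z : ℂ) ^ (-p) • v}

/-- The Mumford-Tate group. -/
def mumfordTate : SubGL ℚ d := SubGL.generated V.gIso ℂ V.muImage

/-- The decomposable Hodge group `MT ∩ Iso`. -/
def decomposableHodge : SubGL ℚ d := SubGL.inter V.mumfordTate V.iso

/-- The Hodge group. -/
def hodgeGroup : SubGL ℚ d := SubGL.idComp V.decomposableHodge

/-- The ring `D ⊆ End(V)` preserves the Hodge decomposition. -/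
def Preserves (D : Subalgebra ℚ (Matrix (Fin d) (Fin d) ℚ)) : Prop :=
  ∀ β ∈ D, ∀ p, ∀ v ∈ V.hdg p, (β.map (algebraMap ℚ ℂ)).mulVec v ∈ V.hdg p

variable (D : Subalgebra ℚ (Matrix (Fin d) (Fin d) ℚ))

/-- `{g ∈ Iso : g β g⁻¹ = a(β) for all β ∈ D}`. -/
def twistedCentralizer (a : D ≃ₐ[ℚ] D) : SubGL ℚ d :=
  fun R _ _ => {g : GL (Fin d) R | g ∈ V.iso R ∧ ∀ β : D,
    (g : Matrix (Fin d) (Fin d) R) *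
        (β : Matrix (Fin d) (Fin d) ℚ).map (algebraMap ℚ R) *
        ((g⁻¹ : GL (Fin d) R) : Matrix (Fin d) (Fin d) R) =
      ((a β : D) : Matrix (Fin d) (Fin d) ℚ).map (algebraMap ℚ R)}

/-- The centralizer `C_D(Iso_{(V, ψ)})`. -/
def centralizer : SubGL ℚ d :=
  fun R _ _ => {g : GL (Fin d) R | g ∈ V.iso R ∧ ∀ β ∈ D,
    (g : Matrix (Fin d) (Fin d) R) * β.map (algebraMap ℚ R) =
      β.map (algebraMap ℚ R) * (g : Matrix (Fin d) (Fin d) R)}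

/-- The Lefschetz group `L(V, ψ, D) = C_D(Iso)°`. -/
def lefschetz : SubGL ℚ d := SubGL.idComp (V.centralizer D)

variable {F Fbar : Type*} [Field F] [Field Fbar] [Algebra F Fbar]

/-- The field `K_e`: the fixed field of the kernel of the restriction of `ρ_e` to `G_K`. -/
def fieldKe {D : Subalgebra ℚ (Matrix (Fin d) (Fin d) ℚ)}
    (ρe : (Fbar ≃ₐ[F] Fbar) →* (D ≃ₐ[ℚ] D)) (K : IntermediateField F Fbar) :
    IntermediateField F Fbar :=
  IntermediateField.fixedField (K.fixingSubgroup ⊓ ρe.ker)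

variable {D} in
/-- The twisted decomposable Lefschetz group `DL_K(V, ψ, D)`: the union of the twists `DL_K^τ`,
which depend only on the class `τ` of `σ ∈ G_K` in `Gal(K_e / K) = G_K / ker ρ_e`. -/
def twistedLefschetz (ρe : (Fbar ≃ₐ[F] Fbar) →* (D ≃ₐ[ℚ] D)) (K : IntermediateField F Fbar) :
    SubGL ℚ d :=
  SubGL.union fun σ : K.fixingSubgroup => V.twistedCentralizer D (ρe σ)

end PolarizedHodge

/-! ### Families of `l`-adic representations and the algebraic Sato-Tate conjecture -/

section Galois

variable {F Fbar : Type*} [Field F] [Field Fbar] [Algebra F Fbar] {d : ℕ} {n : ℤ}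

/-- `G_{l,K}^alg`: the Zariski closure of `ρ_l(G_K)`. -/
def galoisAlg {l : ℕ} [Fact l.Prime] (ρl : (Fbar ≃ₐ[F] Fbar) →* GL (Fin d) ℚ_[l])
    (K : IntermediateField F Fbar) : SubGL ℚ_[l] d :=
  SubGL.zariskiClosure (ρl '' (K.fixingSubgroup : Set (Fbar ≃ₐ[F] Fbar)))

/-- `G_{l,K,1}^alg = G_{l,K}^alg ∩ Iso_{(V_l, ψ_l)}`. -/
def galoisAlgOne (V : PolarizedHodge d n) {l : ℕ} [Fact l.Prime]
    (ρl : (Fbar ≃ₐ[F] Fbar) →* GL (Fin d) ℚ_[l])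
    (K : IntermediateField F Fbar) : SubGL ℚ_[l] d :=
  SubGL.inter (galoisAlg ρl K) (V.iso.baseChange ℚ_[l])

/-- The polarization `ψ_l : V_l × V_l → ℚ_l(-n)` is Galois equivariant. -/
def FormEquivariant (V : PolarizedHodge d n) {l : ℕ} [Fact l.Prime]
    (ρl : (Fbar ≃ₐ[F] Fbar) →* GL (Fin d) ℚ_[l]) : Prop :=
  ∀ (σ : Fbar ≃ₐ[F] Fbar) (v w : Fin d → ℚ_[l]),
    formOn V.psi ℚ_[l] ((ρl σ : Matrix (Fin d) (Fin d) ℚ_[l]).mulVec v)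
        ((ρl σ : Matrix (Fin d) (Fin d) ℚ_[l]).mulVec w) =
      (((cyclotomicCharacter Fbar l (σ : Fbar ≃+* Fbar) ^ (-n) : ℤ_[l]ˣ) : ℤ_[l]) : ℚ_[l]) *
        formOn V.psi ℚ_[l] v w

/-- The action of `D` on `V_l` is Galois equivariant: `ρ_l(σ) (β v) = σ(β) ρ_l(σ) v`. -/
def ActionEquivariant {D : Subalgebra ℚ (Matrix (Fin d) (Fin d) ℚ)}
    (ρe : (Fbar ≃ₐ[F] Fbar) →* (D ≃ₐ[ℚ] D)) {l : ℕ} [Fact l.Prime]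
    (ρl : (Fbar ≃ₐ[F] Fbar) →* GL (Fin d) ℚ_[l]) : Prop :=
  ∀ (σ : Fbar ≃ₐ[F] Fbar) (β : D) (v : Fin d → ℚ_[l]),
    (ρl σ : Matrix (Fin d) (Fin d) ℚ_[l]).mulVec
        (((β : Matrix (Fin d) (Fin d) ℚ).map (algebraMap ℚ ℚ_[l])).mulVec v) =
      (((ρe σ β : D) : Matrix (Fin d) (Fin d) ℚ).map (algebraMap ℚ ℚ_[l])).mulVec
        ((ρl σ : Matrix (Fin d) (Fin d) ℚ_[l]).mulVec v)

/-- The algebraic Sato-Tate conjecture for the family `(ρ_l)` with the algebraic Sato-Tate groups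
`AST K`, `K / F` finite: they are reductive algebraic subgroups of `Iso_{(V, ψ)}` over `ℚ`, natural
in `K`, and for every prime `l` there are isomorphisms of group schemes
`ast_{l,K} : G_{l,K,1}^alg ≅ (AST K)_{ℚ_l}`, natural in `K`. -/
structure AlgebraicSatoTate (V : PolarizedHodge d n)
    (ρ : ∀ (l : ℕ) [Fact l.Prime], (Fbar ≃ₐ[F] Fbar) →* GL (Fin d) ℚ_[l])
    (AST : IntermediateField F Fbar → SubGL ℚ d) : Prop where
  isAlgSubgroup : ∀ K : IntermediateField F Fbar, FiniteDimensional F K →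
    SubGL.IsAlgSubgroup (AST K)
  contained_iso : ∀ K : IntermediateField F Fbar, FiniteDimensional F K →
    SubGL.Contained (AST K) V.iso
  reductive : ∀ K : IntermediateField F Fbar, FiniteDimensional F K →
    SubGL.IsReductive (AST K)
  antitone : ∀ K L : IntermediateField F Fbar, FiniteDimensional F K → FiniteDimensional F L →
    K ≤ L → SubGL.Contained (AST L) (AST K)
  exists_ast : ∀ (l : ℕ) [Fact l.Prime],
    ∃ ast : IntermediateField F Fbar →
        ∀ (R : Type) [CommRing R] [Algebra ℚ_[l] R], GL (Fin d) R → GL (Fin d) R,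
      (∀ K : IntermediateField F Fbar, FiniteDimensional F K →
        SubGL.IsGroupIso (galoisAlgOne V (ρ l) K) ((AST K).baseChange ℚ_[l]) (ast K)) ∧
      ∀ K L : IntermediateField F Fbar, FiniteDimensional F K → FiniteDimensional F L → K ≤ L →
        ∀ (R : Type) [CommRing R] [Algebra ℚ_[l] R], ∀ g ∈ galoisAlgOne V (ρ l) L R,
          ast L R g = ast K R g

end Galois

end

/-!
The group `DL_K` is the disjoint union of the twists `X_a = {g ∈ Iso : g β g⁻¹ = a(β)}` of
`X_1 = C_D(Iso)`, where `a` runs through the finite image of `G_K` under `ρ_e`. Matrix entries of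
`g β g⁻¹` separate the twists (`exists_separates_conjugationLocus`), so a point of `DL_K` over an
algebra `R` is a partition of `Spec R` together with a point of one `X_a` over each part
(`Separates.restrictTo_mem`, `mem_union_of_restrictTo_mem`). This makes `DL_K` a group scheme
compatible with extension of the base field.

Over `K_e` only the trivial twist occurs, so the hypotheses say that `X_1` is connected and equal to
the Hodge group. In particular `X_1` lies in the Mumford-Tate group `MT`.

* `G_{l,K,1}^alg ⊆ DL_K`, since `ρ_l(σ)` acts on `D` through `ρ_e(σ)`.
* `DL_K ⊆ G_{l,K,1}^alg`. As the weight is nonzero, `MT` contains the homotheties: `μ_∞(z)` times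
  its complex conjugate is `z ^ (-n)` (`scalar_mem_mumfordTate`). The similitude `ρ_l(σ)` times a
  square root of its inverse multiplier, which exists in a quadratic extension of the algebra of
  coefficients, is therefore a point of `G_{l,K}^alg` in the twist by `ρ_e(σ)`, and the whole twist
  is the product of this point with `X_1 ⊆ MT ⊆ G_{l,K}^alg`
  (`twistedCentralizer_contained_zariskiClosure`).
* Both inclusions hold for every finite extension `K'` of `F`, because the identity component of
  `G_{l,K}^alg` is contained in the closure of every subgroup of finite index
  (`idComp_zariskiClosure_contained`), hence `MT ⊆ G_{l,K'}^alg`.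
* `DL_{K'}` is reductive: its identity component is `X_1`, whose complex points are stable under
  adjoints for the definite hermitian form `ψ(w v, v̄)` given by the Weil operator `w`. The fixed
  space of a normal unipotent subgroup has a stable orthogonal complement, which is zero by
  Kolchin's theorem (`MonoidHom.exists_fixed_of_unipotent`). The unipotent radical is tested over
  an algebraic closure of `ℚ`; the Nullstellensatz makes these points dense in the complex ones
  (`IsClosedSubscheme.mem_zariskiClosure`, `eq_one_of_unipotent_of_normal`).
-/

/-! ### Regular functions and closed subschemes -/

namespace SubGL

open MvPolynomial Matrix

variable {k : Type} [Field k] {d : ℕ}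

/-- The generic matrix, whose entries are the coordinate functions `g ↦ g i j`. -/
noncomputable def genericMatrix (k : Type) [Field k] (d : ℕ) :
    Matrix (Fin d) (Fin d) (CoordPoly k d) :=
  Matrix.of fun i j => X (true, i, j)

/-- The inverse of the generic matrix, whose entries are the functions `g ↦ g⁻¹ i j`. -/
noncomputable def genericInverse (k : Type) [Field k] (d : ℕ) :
    Matrix (Fin d) (Fin d) (CoordPoly k d) :=
  Matrix.of fun i j => X (false, i, j)

/-- The coordinates of a point of `GL_d`: the entries of `g` and of `g⁻¹`. -/
def coords {R : Type} [CommRing R] (g : GL (Fin d) R) (x : Bool × Fin d × Fin d) : R :=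
  bif x.1 then (g : Matrix (Fin d) (Fin d) R) x.2.1 x.2.2
  else ((g⁻¹ : GL (Fin d) R) : Matrix (Fin d) (Fin d) R) x.2.1 x.2.2

/-- Evaluation of regular functions at a point, as a homomorphism of algebras. -/
noncomputable def evalHom {R : Type} [CommRing R] [Algebra k R] (g : GL (Fin d) R) :
    CoordPoly k d →ₐ[k] R :=
  aeval (coords g)

variable {R : Type} [CommRing R] [Algebra k R]

theorem regEval_eq (g : GL (Fin d) R) (f : CoordPoly k d) : regEval g f = evalHom g f := rfl

theorem map_genericMatrix (g : GL (Fin d) R) :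
    (genericMatrix k d).map (evalHom g) = (g : Matrix (Fin d) (Fin d) R) := by
  ext i j; simp [genericMatrix, evalHom, coords]

theorem map_genericInverse (g : GL (Fin d) R) :
    (genericInverse k d).map (evalHom g) = ((g⁻¹ : GL (Fin d) R) : Matrix (Fin d) (Fin d) R) := by
  ext i j; simp [genericInverse, evalHom, coords]

theorem map_map_C (g : GL (Fin d) R) (B : Matrix (Fin d) (Fin d) k) :
    (B.map (C : k → CoordPoly k d)).map (evalHom g) = B.map (algebraMap k R) := by
  ext i j; simp [evalHom]

theorem coords_map {S : Type} [CommRing S] (f : R →+* S) (g : GL (Fin d) R) :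
    coords (Matrix.GeneralLinearGroup.map f g) = f ∘ coords g := by
  funext ⟨b, i, j⟩
  cases b
  · simp only [coords, cond_false, Function.comp, ← map_inv]; rfl
  · rfl

/-- Evaluation commutes with homomorphisms of `k`-algebras. -/
theorem regEval_map {S : Type} [CommRing S] [Algebra k S] (φ : R →+* S)
    (hφ : φ.comp (algebraMap k R) = algebraMap k S) (g : GL (Fin d) R) (f : CoordPoly k d) :
    regEval (Matrix.GeneralLinearGroup.map φ g) f = φ (regEval g f) := by
  simp only [regEval_eq, evalHom, coords_map, aeval_def, hom_eval₂, hφ]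
  rfl

/-- Evaluation does not see an extension of the field of coefficients. -/
theorem regEval_map_algebraMap {k' : Type} [Field k'] [Algebra k k'] [Algebra k' R]
    (h : (algebraMap k' R).comp (algebraMap k k') = algebraMap k R)
    (g : GL (Fin d) R) (f : CoordPoly k d) :
    regEval g (MvPolynomial.map (algebraMap k k') f) = regEval g f := by
  simp only [regEval_eq, evalHom, aeval_def, eval₂_map, h]

/-- `X` is a closed subscheme of `GL_d`. -/
def IsClosedSubscheme (X : SubGL k d) : Prop := ∃ S : Set (CoordPoly k d), X = zeroLocus S

theorem isClosedSubscheme_zeroLocus (S : Set (CoordPoly k d)) :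
    IsClosedSubscheme (zeroLocus S) := ⟨S, rfl⟩

/-- A subfunctor given by equations between matrices of regular functions is closed. -/
theorem IsClosedSubscheme.of_matrix {ι : Type*} (X : SubGL k d)
    (M : ι → Matrix (Fin d) (Fin d) (CoordPoly k d))
    (h : ∀ (R : Type) [CommRing R] [Algebra k R] (g : GL (Fin d) R),
      g ∈ X R ↔ ∀ i, (M i).map (evalHom g) = 0) : IsClosedSubscheme X := by
  refine ⟨{f | ∃ i a b, f = M i a b}, ?_⟩
  funext R _ _
  ext g
  rw [h]
  constructor
  · rintro H f ⟨i, a, b, rfl⟩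
    exact congrFun (congrFun (H i) a) b
  · intro H i
    ext a b
    exact H _ ⟨i, a, b, rfl⟩

theorem IsClosedSubscheme.inter {X Y : SubGL k d} (hX : IsClosedSubscheme X)
    (hY : IsClosedSubscheme Y) : IsClosedSubscheme (X.inter Y) := by
  obtain ⟨S, rfl⟩ := hX
  obtain ⟨T, rfl⟩ := hY
  refine ⟨S ∪ T, ?_⟩
  funext R _ _
  ext g
  exact ⟨fun h f hf => hf.elim (h.1 f) (h.2 f),
    fun h => ⟨fun f hf => h f (Or.inl hf), fun f hf => h f (Or.inr hf)⟩⟩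

theorem IsClosedSubscheme.mem_iff {X : SubGL k d} (hX : IsClosedSubscheme X) (g : GL (Fin d) R) :
    g ∈ X R ↔ ∀ f, Vanishes f X → regEval g f = 0 := by
  obtain ⟨S, rfl⟩ := hX
  exact ⟨fun h f hf => hf R g h, fun h f hf => h f fun R _ _ g hg => hg f hf⟩

theorem IsClosedSubscheme.map_mem {X : SubGL k d} (hX : IsClosedSubscheme X)
    {S : Type} [CommRing S] [Algebra k S] (φ : R →+* S)
    (hφ : φ.comp (algebraMap k R) = algebraMap k S) {g : GL (Fin d) R} (hg : g ∈ X R) :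
    Matrix.GeneralLinearGroup.map φ g ∈ X S := by
  obtain ⟨T, rfl⟩ := hX
  intro f hf
  rw [regEval_map φ hφ, hg f hf, map_zero]

theorem IsClosedSubscheme.mem_of_map_mem {X : SubGL k d} (hX : IsClosedSubscheme X)
    {S : Type} [CommRing S] [Algebra k S] (φ : R →+* S)
    (hφ : φ.comp (algebraMap k R) = algebraMap k S) (hinj : Function.Injective φ)
    {g : GL (Fin d) R} (hg : Matrix.GeneralLinearGroup.map φ g ∈ X S) : g ∈ X R := by
  obtain ⟨T, rfl⟩ := hX
  intro f hf
  have := hg f hf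
  rw [regEval_map φ hφ] at this
  exact hinj (by rw [this, map_zero])

theorem IsClosedSubscheme.baseChange {X : SubGL k d} (hX : IsClosedSubscheme X)
    (k' : Type) [Field k'] [Algebra k k'] : IsClosedSubscheme (X.baseChange k') := by
  obtain ⟨T, rfl⟩ := hX
  refine ⟨MvPolynomial.map (algebraMap k k') '' T, ?_⟩
  funext R _ _
  ext g
  let _ : Algebra k R := Algebra.compHom R (algebraMap k k')
  constructor
  · rintro h _ ⟨f, hf, rfl⟩
    rw [regEval_map_algebraMap (k := k) (k' := k') rfl]
    exact h f hf
  · intro h f hf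
    rw [← regEval_map_algebraMap (k := k) (k' := k') rfl]
    exact h _ ⟨f, hf, rfl⟩

theorem mem_zariskiClosure_of_mem {S : Set (GL (Fin d) k)} {g : GL (Fin d) k} (hg : g ∈ S) :
    Matrix.GeneralLinearGroup.map (algebraMap k R) g ∈ zariskiClosure S R := by
  intro f hf
  rw [regEval_map _ (by ext; simp), hf g hg, map_zero]

/-! ### Gluing along a partition of unity -/

/-- The restriction of a point `g` to the closed subscheme of `Spec R` cut out by the annihilator
of `ε`. If `ε` is idempotent, this is the open and closed locus `ε = 1`. -/
noncomputable def restrictTo (ε : R) (g : GL (Fin d) R) :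
    GL (Fin d) (R ⧸ Ideal.torsionOf R R ε) :=
  Matrix.GeneralLinearGroup.map (Ideal.Quotient.mk (Ideal.torsionOf R R ε)) g

theorem regEval_restrictTo_eq_zero_iff (ε : R) (g : GL (Fin d) R) (f : CoordPoly k d) :
    regEval (restrictTo ε g) f = 0 ↔ ε * regEval g f = 0 := by
  rw [restrictTo, regEval_map _ rfl, Ideal.Quotient.eq_zero_iff_mem, Ideal.mem_torsionOf_iff,
    smul_eq_mul, mul_comm]

theorem restrictTo_mul (ε : R) (g h : GL (Fin d) R) :
    restrictTo ε (g * h) = restrictTo ε g * restrictTo ε h := map_mul _ _ _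

theorem restrictTo_inv (ε : R) (g : GL (Fin d) R) :
    restrictTo ε g⁻¹ = (restrictTo ε g)⁻¹ := map_inv _ _

theorem IsClosedSubscheme.restrictTo_mem_iff {X : SubGL k d} (hX : IsClosedSubscheme X)
    (ε : R) (g : GL (Fin d) R) : restrictTo ε g ∈ X (R ⧸ Ideal.torsionOf R R ε) ↔
      ∀ f, Vanishes f X → ε * regEval g f = 0 := by
  simp_rw [hX.mem_iff, regEval_restrictTo_eq_zero_iff]

theorem IsClosedSubscheme.restrictTo_mem {X : SubGL k d} (hX : IsClosedSubscheme X)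
    (ε : R) {g : GL (Fin d) R} (hg : g ∈ X R) :
    restrictTo ε g ∈ X (R ⧸ Ideal.torsionOf R R ε) := by
  rw [hX.restrictTo_mem_iff]
  intro f hf
  rw [hf R g hg, mul_zero]

/-- If the functions `ε i` sum up to `1`, then a point which lies in the closed subscheme `Y i`
over the locus of each `ε i` lies in the union of the `Y i`. -/
theorem mem_union_of_restrictTo_mem {ι J : Type*} [Fintype ι] (ε : ι → R) (hε : ∑ i, ε i = 1)
    (g : GL (Fin d) R) (Y : J → SubGL k d)
    (h : ∀ i, ∃ j, restrictTo (ε i) g ∈ Y j (R ⧸ Ideal.torsionOf R R (ε i))) :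
    g ∈ union Y R := by
  intro f hf
  have key : ∀ i, ε i * regEval g f = 0 := by
    intro i
    obtain ⟨j, hj⟩ := h i
    exact (regEval_restrictTo_eq_zero_iff _ _ _).1 (hf j _ _ hj)
  rw [← one_mul (regEval g f), ← hε, Finset.sum_mul, Finset.sum_eq_zero fun i _ => key i]

/-- Regular functions `e i` which separate the members of a family of subschemes: `e i` is `1` on
`X i` and `0` on the others. -/
structure Separates {ι : Type*} (e : ι → CoordPoly k d) (X : ι → SubGL k d) : Prop where
  eq_one : ∀ i (R : Type) [CommRing R] [Algebra k R], ∀ g ∈ X i R, regEval g (e i) = 1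
  eq_zero : ∀ i j, i ≠ j → ∀ (R : Type) [CommRing R] [Algebra k R], ∀ g ∈ X j R,
    regEval g (e i) = 0

theorem Separates.sum_eq_one {ι : Type*} [Fintype ι] {e : ι → CoordPoly k d}
    {X : ι → SubGL k d} (h : Separates e X) {g : GL (Fin d) R} (hg : g ∈ union X R) :
    ∑ i, regEval g (e i) = 1 := by
  classical
  have := hg (∑ i, e i - 1) (fun j R _ _ x hx => by
    rw [regEval_eq, map_sub, map_sum, map_one, sub_eq_zero]
    refine (Finset.sum_eq_single j (fun i _ hij => ?_) (by simp)).trans (h.eq_one j R x hx)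
    exact h.eq_zero i j hij R x hx)
  rwa [regEval_eq, map_sub, map_sum, map_one, sub_eq_zero] at this

/-- Over the locus of `e i`, a point of the union lies in `X i`. -/
theorem Separates.restrictTo_mem {ι : Type*} {e : ι → CoordPoly k d}
    {X : ι → SubGL k d} (h : Separates e X) (i : ι) (hX : IsClosedSubscheme (X i))
    {g : GL (Fin d) R} (hg : g ∈ union X R) :
    restrictTo (regEval g (e i)) g ∈ X i (R ⧸ Ideal.torsionOf R R (regEval g (e i))) := by
  rw [hX.restrictTo_mem_iff]
  intro f hf
  have := hg (e i * f) (fun j R _ _ x hx => by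
    rw [regEval_eq, map_mul]
    by_cases hij : i = j
    · subst hij
      exact mul_eq_zero_of_right _ (hf R x hx)
    · exact mul_eq_zero_of_left (h.eq_zero i j hij R x hx) _)
  rwa [regEval_eq, map_mul] at this

theorem Separates.mono {ι : Type*} {e : ι → CoordPoly k d} {X Y : ι → SubGL k d}
    (h : Separates e Y) (hXY : ∀ i, Contained (X i) (Y i)) : Separates e X :=
  ⟨fun i R _ _ g hg => h.eq_one i R g (hXY i R hg),
    fun i j hij R _ _ g hg => h.eq_zero i j hij R g (hXY j R hg)⟩

theorem Separates.baseChange {ι : Type*} {e : ι → CoordPoly k d} {X : ι → SubGL k d}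
    (h : Separates e X) (k' : Type) [Field k'] [Algebra k k'] :
    Separates (fun i => MvPolynomial.map (algebraMap k k') (e i))
      (fun i => (X i).baseChange k') := by
  constructor
  · intro i R _ _ g hg
    let _ : Algebra k R := Algebra.compHom R (algebraMap k k')
    rw [regEval_map_algebraMap (k := k) (k' := k') rfl]
    exact h.eq_one i R g hg
  · intro i j hij R _ _ g hg
    let _ : Algebra k R := Algebra.compHom R (algebraMap k k')
    rw [regEval_map_algebraMap (k := k) (k' := k') rfl]
    exact h.eq_zero i j hij R g hg

theorem mem_union_of_mem {J : Type*} (X : J → SubGL k d) (j : J) {g : GL (Fin d) R}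
    (hg : g ∈ X j R) : g ∈ union X R := fun _ hf => hf j R g hg

theorem union_contained {J : Type*} {X : J → SubGL k d} {Y : SubGL k d}
    (hY : IsClosedSubscheme Y) (h : ∀ j, Contained (X j) Y) : Contained (union X) Y :=
  fun _ _ _ g hg => (hY.mem_iff g).2 fun f hf => hg f fun j A _ _ x hx => hf A x (h j A hx)

/-- For a family separated by regular functions, a union may be intersected member by member. -/
theorem Separates.inter_union_contained {ι : Type*} [Fintype ι] {e : ι → CoordPoly k d}
    {X : ι → SubGL k d} (h : Separates e X) (hX : ∀ i, IsClosedSubscheme (X i)) {Y : SubGL k d}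
    (hY : IsClosedSubscheme Y) :
    Contained (inter (union X) Y) (union fun i => inter (X i) Y) := fun _ _ _ g hg =>
  mem_union_of_restrictTo_mem (fun i => regEval g (e i)) (h.sum_eq_one hg.1) g _
    fun i => ⟨i, h.restrictTo_mem i (hX i) hg.1, hY.restrictTo_mem _ hg.2⟩

/-- The formation of a union of subschemes separated by regular functions commutes with an
extension of the base field. -/
theorem Separates.baseChange_union {ι : Type*} [Fintype ι] {e : ι → CoordPoly k d}
    {X : ι → SubGL k d} (h : Separates e X) (hX : ∀ i, IsClosedSubscheme (X i))
    (k' : Type) [Field k'] [Algebra k k'] :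
    (union X).baseChange k' = union fun i => (X i).baseChange k' := by
  funext R _ _
  ext g
  let _ : Algebra k R := Algebra.compHom R (algebraMap k k')
  constructor
  · intro hg
    exact mem_union_of_restrictTo_mem (k := k') (fun i => regEval g (e i))
      (h.sum_eq_one (k := k) hg) g _ fun i => ⟨i, h.restrictTo_mem i (hX i) hg⟩
  · intro hg
    exact union_contained ((isClosedSubscheme_zeroLocus _).baseChange k')
      (fun j A _ _ _ hx =>
        let _ : Algebra k A := Algebra.compHom A (algebraMap k k')
        mem_union_of_mem X j hx) _ hg

/-! ### Transfer along an extension of the coefficients -/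

/-- If every polynomial over `k` that vanishes on the set `S` of `k`-points vanishes at the
`R`-point `x`, then so does every polynomial with coefficients in `R` that vanishes on `S`: expand
its coefficients in a basis of `R` over `k`. -/
theorem eval_eq_zero_of_aeval_eq_zero {σ k R : Type*} [Field k] [CommRing R] [Algebra k R]
    (S : Set (σ → k)) (x : σ → R)
    (h : ∀ f : MvPolynomial σ k, (∀ s ∈ S, eval s f = 0) → aeval x f = 0)
    (F : MvPolynomial σ R) (hF : ∀ s ∈ S, eval (fun i => algebraMap k R (s i)) F = 0) :
    eval x F = 0 := by
  classical
  let b := Module.Basis.ofVectorSpace k R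
  let G : _ → MvPolynomial σ k := fun i => ∑ m ∈ F.support, monomial m (b.repr (F.coeff m) i)
  have hG : ∀ i, aeval x (G i) = 0 := by
    intro i
    refine h _ fun s hs => ?_
    have h1 : b.repr (eval (fun i => algebraMap k R (s i)) F) i = 0 := by
      rw [hF s hs]; simp
    rw [eval_eq, map_sum, Finsupp.finsetSum_apply] at h1
    rw [map_sum, ← h1]
    refine Finset.sum_congr rfl fun m _ => ?_
    rw [eval_monomial, Finsupp.prod, mul_comm (F.coeff m)]
    simp_rw [← map_pow, ← map_prod]
    rw [← Algebra.smul_def, map_smul]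
    simp [mul_comm]
  let T : Finset _ := F.support.biUnion fun m => (b.repr (F.coeff m)).support
  have hT : ∀ m ∈ F.support, F.coeff m = ∑ i ∈ T, b.repr (F.coeff m) i • b i := by
    intro m hm
    conv_lhs => rw [← b.linearCombination_repr (F.coeff m), Finsupp.linearCombination_apply,
      Finsupp.sum]
    refine Finset.sum_subset (Finset.subset_biUnion_of_mem
      (fun m => (b.repr (F.coeff m)).support) hm) fun i _ hi => ?_
    rw [Finsupp.notMem_support_iff.1 hi, zero_smul]
  calc eval x F = ∑ m ∈ F.support, F.coeff m * ∏ i ∈ m.support, x i ^ m i := eval_eq _ _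
    _ = ∑ m ∈ F.support, ∑ i ∈ T, b i * (algebraMap k R (b.repr (F.coeff m) i) *
          ∏ i ∈ m.support, x i ^ m i) := by
        refine Finset.sum_congr rfl fun m hm => ?_
        conv_lhs => rw [hT m hm, Finset.sum_mul]
        exact Finset.sum_congr rfl fun i _ => by rw [Algebra.smul_def]; ring
    _ = ∑ i ∈ T, b i * aeval x (G i) := by
        rw [Finset.sum_comm]
        refine Finset.sum_congr rfl fun i _ => ?_
        rw [map_sum, Finset.mul_sum]
        exact Finset.sum_congr rfl fun m _ => by rw [aeval_monomial, Finsupp.prod]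
    _ = 0 := Finset.sum_eq_zero fun i _ => by rw [hG, mul_zero]

/-- The regular functions on `GL_d` with coefficients in `R`, as functions on the points over
`R`. -/
noncomputable def regularFunctions (R : Type) [CommRing R] (d : ℕ) :
    Subalgebra R (GL (Fin d) R → R) where
  carrier := {F | ∃ p : MvPolynomial (Bool × Fin d × Fin d) R, ∀ g, eval (coords g) p = F g}
  mul_mem' := by
    rintro F G ⟨p, hp⟩ ⟨q, hq⟩
    exact ⟨p * q, fun g => by rw [map_mul, hp, hq]; rfl⟩
  add_mem' := by
    rintro F G ⟨p, hp⟩ ⟨q, hq⟩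
    exact ⟨p + q, fun g => by rw [map_add, hp, hq]; rfl⟩
  algebraMap_mem' c := ⟨C c, fun g => by rw [eval_C]; rfl⟩

theorem mem_regularFunctions_iff {F : GL (Fin d) R → R} : F ∈ regularFunctions R d ↔
    ∃ p : MvPolynomial (Bool × Fin d × Fin d) R, ∀ g, eval (coords g) p = F g := Iff.rfl

theorem coords_mem_regularFunctions (x : Bool × Fin d × Fin d) :
    (fun g => coords g x) ∈ regularFunctions R d :=
  mem_regularFunctions_iff.2 ⟨X x, fun g => by simp⟩

theorem entry_mem_regularFunctions (i j : Fin d) :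
    (fun g : GL (Fin d) R => (g : Matrix (Fin d) (Fin d) R) i j) ∈ regularFunctions R d :=
  coords_mem_regularFunctions (true, i, j)

theorem inv_entry_mem_regularFunctions (i j : Fin d) :
    (fun g : GL (Fin d) R => ((g⁻¹ : GL (Fin d) R) : Matrix (Fin d) (Fin d) R) i j) ∈
      regularFunctions R d :=
  coords_mem_regularFunctions (false, i, j)

theorem const_mem_regularFunctions (c : R) : (fun _ => c) ∈ regularFunctions R d :=
  (regularFunctions R d).algebraMap_mem c

/-- The pullback of a regular function along a regular map is regular. -/
theorem regEval_comp_mem_regularFunctions (m : GL (Fin d) R → GL (Fin d) R)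
    (hm : ∀ x, (fun g => coords (m g) x) ∈ regularFunctions R d) (f : CoordPoly k d) :
    (fun g => regEval (m g) f) ∈ regularFunctions R d := by
  induction f using MvPolynomial.induction_on with
  | C a =>
    simp only [regEval_eq, evalHom, aeval_C]
    exact const_mem_regularFunctions _
  | add p q hp hq =>
    simp only [regEval_eq, map_add] at hp hq ⊢
    exact add_mem hp hq
  | mul_X p x hp =>
    simp only [regEval_eq, map_mul] at hp ⊢
    refine mul_mem hp ?_
    simp only [evalHom, aeval_X]
    exact hm x

/-- A regular function with coefficients in `R` that vanishes on a set of `k`-points vanishes on the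
`R`-points of the Zariski closure of this set. -/
theorem eq_zero_of_mem_zariskiClosure {S : Set (GL (Fin d) k)} {g : GL (Fin d) R}
    (hg : g ∈ zariskiClosure S R) {F : GL (Fin d) R → R} (hF : F ∈ regularFunctions R d)
    (h : ∀ s ∈ S, F (Matrix.GeneralLinearGroup.map (algebraMap k R) s) = 0) : F g = 0 := by
  obtain ⟨p, hp⟩ := mem_regularFunctions_iff.1 hF
  rw [← hp]
  refine eval_eq_zero_of_aeval_eq_zero (coords '' S) _ (fun f hf => ?_) p ?_
  · exact hg f fun s hs => by
      rw [regEval_eq, evalHom, aeval_eq_eval]; exact hf _ ⟨s, hs, rfl⟩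
  · rintro _ ⟨s, hs, rfl⟩
    have := h s hs
    rwa [← hp, coords_map] at this

theorem coords_mul_mem_regularFunctions (a : GL (Fin d) R) (x : Bool × Fin d × Fin d) :
    (fun g => coords (g * a) x) ∈ regularFunctions R d := by
  obtain ⟨b, i, j⟩ := x
  cases b
  · simp only [coords, cond_false, _root_.mul_inv_rev, Units.val_mul, Matrix.mul_apply]
    convert! sum_mem (S := regularFunctions R d) (t := Finset.univ) fun l _ => mul_mem
      (const_mem_regularFunctions (((a⁻¹ : GL (Fin d) R) : Matrix (Fin d) (Fin d) R) i l))
      (inv_entry_mem_regularFunctions l j) using 1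
    ext g; simp
  · simp only [coords, cond_true, Units.val_mul, Matrix.mul_apply]
    convert! sum_mem (S := regularFunctions R d) (t := Finset.univ) fun l _ => mul_mem
      (entry_mem_regularFunctions i l)
      (const_mem_regularFunctions ((a : Matrix (Fin d) (Fin d) R) l j)) using 1
    ext g; simp

theorem coords_mul_inv_mem_regularFunctions (a : GL (Fin d) R) (x : Bool × Fin d × Fin d) :
    (fun g => coords (a * g⁻¹) x) ∈ regularFunctions R d := by
  have h : ∀ g : GL (Fin d) R, coords (a * g⁻¹) x = coords (g * a⁻¹) (!x.1, x.2) := by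
    intro g
    obtain ⟨b, i, j⟩ := x
    cases b <;> simp [coords]
  simp_rw [h]
  exact coords_mul_mem_regularFunctions _ _

theorem mulVec_mem_regularFunctions (x : Fin d → R) (i : Fin d) :
    (fun g : GL (Fin d) R => ((g : Matrix (Fin d) (Fin d) R).mulVec x) i) ∈
      regularFunctions R d := by
  convert! sum_mem (S := regularFunctions R d) (t := Finset.univ) fun l _ => mul_mem
    (entry_mem_regularFunctions (R := R) i l) (const_mem_regularFunctions (x l)) using 1
  ext g
  simp [Matrix.mulVec, dotProduct]

theorem mulVec_mulVec_mem_regularFunctions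
    (B : Matrix (Fin d) (Fin d) R) (x : Fin d → R) (i : Fin d) :
    (fun g : GL (Fin d) R => (B.mulVec ((g : Matrix (Fin d) (Fin d) R).mulVec x)) i) ∈
      regularFunctions R d := by
  convert! sum_mem (S := regularFunctions R d) (t := Finset.univ) fun l _ => mul_mem
    (const_mem_regularFunctions (B i l)) (mulVec_mem_regularFunctions x l) using 1
  ext g
  simp [Matrix.mulVec, dotProduct]

/-- The Zariski closure of a group of points is a group scheme. -/
theorem mul_inv_mem_zariskiClosure (Γ : Subgroup (GL (Fin d) k)) {g h : GL (Fin d) R}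
    (hg : g ∈ zariskiClosure (Γ : Set (GL (Fin d) k)) R)
    (hh : h ∈ zariskiClosure (Γ : Set (GL (Fin d) k)) R) :
    h * g⁻¹ ∈ zariskiClosure (Γ : Set (GL (Fin d) k)) R := by
  intro f hf
  refine eq_zero_of_mem_zariskiClosure hh (F := fun x => regEval (x * g⁻¹) f)
    (regEval_comp_mem_regularFunctions _ (coords_mul_mem_regularFunctions _) f) fun s hs => ?_
  refine eq_zero_of_mem_zariskiClosure hg
    (F := fun x => regEval (Matrix.GeneralLinearGroup.map (algebraMap k R) s * x⁻¹) f)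
    (regEval_comp_mem_regularFunctions _ (coords_mul_inv_mem_regularFunctions _) f) fun t ht => ?_
  rw [← map_inv, ← map_mul, regEval_map _ (by ext; simp), hf _ (Γ.mul_mem hs (Γ.inv_mem ht)),
    map_zero]

theorem one_mem_zariskiClosure (Γ : Subgroup (GL (Fin d) k)) :
    (1 : GL (Fin d) R) ∈ zariskiClosure (Γ : Set (GL (Fin d) k)) R := by
  have := mem_zariskiClosure_of_mem (R := R) (S := (Γ : Set (GL (Fin d) k))) Γ.one_mem
  rwa [map_one] at this

theorem mul_mem_zariskiClosure (Γ : Subgroup (GL (Fin d) k)) {g h : GL (Fin d) R}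
    (hg : g ∈ zariskiClosure (Γ : Set (GL (Fin d) k)) R)
    (hh : h ∈ zariskiClosure (Γ : Set (GL (Fin d) k)) R) :
    g * h ∈ zariskiClosure (Γ : Set (GL (Fin d) k)) R := by
  have h1 := mul_inv_mem_zariskiClosure Γ hh (one_mem_zariskiClosure Γ)
  simpa using mul_inv_mem_zariskiClosure Γ h1 hg

end SubGL

namespace SubGL

open MvPolynomial Matrix

variable {k : Type} [Field k] {d : ℕ} {R : Type} [CommRing R] [Algebra k R]

theorem IsClosedSubscheme.restrictTo_mul_mem_left {X : SubGL k d} (hX : IsClosedSubscheme X)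
    {ε δ : R} {g : GL (Fin d) R} (hg : restrictTo ε g ∈ X (R ⧸ Ideal.torsionOf R R ε)) :
    restrictTo (ε * δ) g ∈ X (R ⧸ Ideal.torsionOf R R (ε * δ)) := by
  rw [hX.restrictTo_mem_iff] at hg ⊢
  intro f hf
  rw [mul_right_comm, hg f hf, zero_mul]

theorem IsClosedSubscheme.restrictTo_mul_mem_right {X : SubGL k d} (hX : IsClosedSubscheme X)
    {ε δ : R} {g : GL (Fin d) R} (hg : restrictTo δ g ∈ X (R ⧸ Ideal.torsionOf R R δ)) :
    restrictTo (ε * δ) g ∈ X (R ⧸ Ideal.torsionOf R R (ε * δ)) := by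
  rw [mul_comm]
  exact hX.restrictTo_mul_mem_left hg

/-- A finite union of closed subschemes `X a`, indexed by a group and separated by regular
functions, is an algebraic subgroup if `X a * X b ⊆ X (a * b)` and `(X a)⁻¹ ⊆ X a⁻¹`. -/
theorem Separates.isAlgSubgroup_union {A : Type*} [Group A] [Fintype A] {X : A → SubGL k d}
    {e : A → CoordPoly k d} (he : Separates e X) (hX : ∀ a, IsClosedSubscheme (X a))
    (one : ∀ (R : Type) [CommRing R] [Algebra k R], (1 : GL (Fin d) R) ∈ X 1 R)
    (mul : ∀ (a b : A) (R : Type) [CommRing R] [Algebra k R], ∀ g ∈ X a R, ∀ h ∈ X b R,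
      g * h ∈ X (a * b) R)
    (inv : ∀ (a : A) (R : Type) [CommRing R] [Algebra k R], ∀ g ∈ X a R, g⁻¹ ∈ X a⁻¹ R) :
    IsAlgSubgroup (union X) where
  closed := isClosedSubscheme_zeroLocus _
  one_mem R _ _ := mem_union_of_mem X 1 (one R)
  mul_mem R _ _ g hg h hh := by
    refine mem_union_of_restrictTo_mem
      (fun p : A × A => regEval g (e p.1) * regEval h (e p.2)) ?_ _ _ fun p => ⟨p.1 * p.2, ?_⟩
    · rw [Fintype.sum_prod_type]
      simp_rw [← Finset.mul_sum, he.sum_eq_one hh, mul_one, he.sum_eq_one hg]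
    · rw [restrictTo_mul]
      exact mul _ _ _ _ ((hX _).restrictTo_mul_mem_left (he.restrictTo_mem _ (hX _) hg)) _
        ((hX _).restrictTo_mul_mem_right (he.restrictTo_mem _ (hX _) hh))
  inv_mem R _ _ g hg := by
    refine mem_union_of_restrictTo_mem (fun a => regEval g (e a)) (he.sum_eq_one hg) _ _
      fun a => ⟨a⁻¹, ?_⟩
    rw [restrictTo_inv]
    exact inv _ _ _ (he.restrictTo_mem _ (hX _) hg)

theorem union_comp_surjective {I J : Type*} (X : J → SubGL k d) {p : I → J}
    (hp : Function.Surjective p) : union (fun i => X (p i)) = union X := by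
  have : {f | ∀ i, Vanishes f (X (p i))} = {f | ∀ j, Vanishes f (X j)} :=
    Set.ext fun f => (hp.forall (p := fun j => Vanishes f (X j))).symm
  simp only [union, this]

theorem IsClosedSubscheme.union_const {X : SubGL k d} (hX : IsClosedSubscheme X) {J : Type*}
    [Nonempty J] : union (fun _ : J => X) = X := by
  funext R _ _
  ext g
  exact ⟨fun hg => union_contained (X := fun _ : J => X) hX (fun _ _ _ _ _ h => h) R hg,
    fun hg => mem_union_of_mem (fun _ : J => X) (Classical.arbitrary J) hg⟩

end SubGL

/-! ### Twisted centralizers -/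

namespace PolarizedHodge

open SubGL MvPolynomial Matrix

variable {d : ℕ} {n : ℤ} (V : PolarizedHodge d n)

theorem mem_iso_iff {R : Type} [CommRing R] [Algebra ℚ R] (g : GL (Fin d) R) :
    g ∈ V.iso R ↔ (g : Matrix (Fin d) (Fin d) R)ᵀ * V.psi.map (algebraMap ℚ R) *
      (g : Matrix (Fin d) (Fin d) R) = V.psi.map (algebraMap ℚ R) := by
  have h : ∀ v w : Fin d → R, formOn V.psi R ((g : Matrix (Fin d) (Fin d) R) *ᵥ v)
      ((g : Matrix (Fin d) (Fin d) R) *ᵥ w) =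
      v ⬝ᵥ ((g : Matrix (Fin d) (Fin d) R)ᵀ * V.psi.map (algebraMap ℚ R) *
        (g : Matrix (Fin d) (Fin d) R)) *ᵥ w := by
    intro v w
    rw [formOn, ← Matrix.mulVec_mulVec, ← Matrix.mulVec_mulVec, Matrix.dotProduct_mulVec v,
      Matrix.vecMul_transpose]
  constructor
  · intro hg
    ext i j
    have := hg (Pi.single i 1) (Pi.single j 1)
    rw [h, formOn] at this
    simpa using this
  · intro hg v w
    rw [h, hg, formOn]

theorem isClosedSubscheme_iso : IsClosedSubscheme V.iso := by
  refine .of_matrix (ι := Unit) _ (fun _ => (genericMatrix ℚ d)ᵀ * V.psi.map C *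
    genericMatrix ℚ d - V.psi.map C) fun R _ _ g => ?_
  rw [V.mem_iso_iff, ← sub_eq_zero, forall_const]
  have : ((genericMatrix ℚ d)ᵀ * V.psi.map C * genericMatrix ℚ d - V.psi.map C).map (evalHom g) =
      (g : Matrix (Fin d) (Fin d) R)ᵀ * V.psi.map (algebraMap ℚ R) *
        (g : Matrix (Fin d) (Fin d) R) - V.psi.map (algebraMap ℚ R) := by
    rw [Matrix.map_sub _ (map_sub _), Matrix.map_mul, Matrix.map_mul, Matrix.transpose_map,
      map_genericMatrix, map_map_C]
  rw [this]

/-- The points of `GL_V` whose conjugation action on `D` is the automorphism `a`. -/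
def conjugationLocus (D : Subalgebra ℚ (Matrix (Fin d) (Fin d) ℚ)) (a : D ≃ₐ[ℚ] D) : SubGL ℚ d :=
  fun R _ _ => {g : GL (Fin d) R | ∀ β : D,
    (g : Matrix (Fin d) (Fin d) R) *
        (β : Matrix (Fin d) (Fin d) ℚ).map (algebraMap ℚ R) *
        ((g⁻¹ : GL (Fin d) R) : Matrix (Fin d) (Fin d) R) =
      ((a β : D) : Matrix (Fin d) (Fin d) ℚ).map (algebraMap ℚ R)}

variable (D : Subalgebra ℚ (Matrix (Fin d) (Fin d) ℚ))

theorem map_conjugate {R : Type} [CommRing R] [Algebra ℚ R] (g : GL (Fin d) R)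
    (β : Matrix (Fin d) (Fin d) ℚ) :
    (genericMatrix ℚ d * β.map C * genericInverse ℚ d).map (evalHom g) =
      (g : Matrix (Fin d) (Fin d) R) * β.map (algebraMap ℚ R) *
        ((g⁻¹ : GL (Fin d) R) : Matrix (Fin d) (Fin d) R) := by
  rw [Matrix.map_mul, Matrix.map_mul, map_genericMatrix, map_genericInverse, map_map_C]

theorem isClosedSubscheme_conjugationLocus (a : D ≃ₐ[ℚ] D) :
    IsClosedSubscheme (conjugationLocus D a) := by
  refine .of_matrix (ι := D) _ (fun β => genericMatrix ℚ d *
    (β : Matrix (Fin d) (Fin d) ℚ).map C * genericInverse ℚ d -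
      ((a β : D) : Matrix (Fin d) (Fin d) ℚ).map C) fun R _ _ g => ?_
  refine forall_congr' fun β => ?_
  rw [← sub_eq_zero, Matrix.map_sub _ (map_sub _), map_conjugate, map_map_C]

theorem twistedCentralizer_eq (a : D ≃ₐ[ℚ] D) :
    V.twistedCentralizer D a = inter (conjugationLocus D a) V.iso := by
  funext R _ _
  ext g
  exact and_comm

theorem isClosedSubscheme_twistedCentralizer (a : D ≃ₐ[ℚ] D) :
    IsClosedSubscheme (V.twistedCentralizer D a) := by
  rw [twistedCentralizer_eq]
  exact (isClosedSubscheme_conjugationLocus D a).inter V.isClosedSubscheme_iso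

/-- Distinct automorphisms of `D` differ in an entry of some matrix, so that suitable matrix
entries of `g β g⁻¹` tell apart the loci of a finite set of automorphisms. -/
theorem exists_separates_conjugationLocus {ι : Type*} [Finite ι] (a : ι → (D ≃ₐ[ℚ] D))
    (ha : Function.Injective a) :
    ∃ e : ι → CoordPoly ℚ d, Separates e fun i => conjugationLocus D (a i) := by
  classical
  cases nonempty_fintype ι
  have key : ∀ i j, ∃ f : CoordPoly ℚ d, i ≠ j →
      (∀ (R : Type) [CommRing R] [Algebra ℚ R], ∀ g ∈ conjugationLocus D (a i) R,
        regEval g f = 1) ∧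
      (∀ (R : Type) [CommRing R] [Algebra ℚ R], ∀ g ∈ conjugationLocus D (a j) R,
        regEval g f = 0) := by
    intro i j
    by_cases hij : i = j
    · exact ⟨0, fun h => (h hij).elim⟩
    have : ∃ β : D, ∃ s t, (a i β : Matrix (Fin d) (Fin d) ℚ) s t ≠
        (a j β : Matrix (Fin d) (Fin d) ℚ) s t := by
      by_contra! H
      exact hij (ha (AlgEquiv.ext fun β => Subtype.ext (Matrix.ext (H β))))
    obtain ⟨β, s, t, hst⟩ := this
    have hq := sub_ne_zero.2 hst
    set q := (a i β : Matrix (Fin d) (Fin d) ℚ) s t - (a j β : Matrix (Fin d) (Fin d) ℚ) s t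
      with hqdef
    have ev : ∀ (l : ι) (R : Type) [CommRing R] [Algebra ℚ R], ∀ g ∈ conjugationLocus D (a l) R,
        regEval g (C q⁻¹ * ((genericMatrix ℚ d * (β : Matrix (Fin d) (Fin d) ℚ).map C *
          genericInverse ℚ d : Matrix (Fin d) (Fin d) (CoordPoly ℚ d)) s t -
            C ((a j β : Matrix (Fin d) (Fin d) ℚ) s t))) =
        algebraMap ℚ R (q⁻¹ * ((a l β : Matrix (Fin d) (Fin d) ℚ) s t -
          (a j β : Matrix (Fin d) (Fin d) ℚ) s t)) := by
      intro l R _ _ g hg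
      have h1 := congrFun (congrFun ((map_conjugate g β).trans (hg β)) s) t
      rw [Matrix.map_apply, Matrix.map_apply] at h1
      rw [regEval_eq, map_mul, map_sub, h1, map_mul, map_sub]
      simp [evalHom]
    refine ⟨_, fun _ => ⟨fun R _ _ g hg => (ev i R g hg).trans ?_,
      fun R _ _ g hg => (ev j R g hg).trans ?_⟩⟩
    · rw [← hqdef, inv_mul_cancel₀ hq, map_one]
    · rw [sub_self, mul_zero, map_zero]
  choose f hf using key
  refine ⟨fun i => ∏ j ∈ Finset.univ.erase i, f i j, fun i R _ _ g hg => ?_,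
    fun i j hij R _ _ g hg => ?_⟩
  · rw [regEval_eq, map_prod]
    exact Finset.prod_eq_one fun j hj => (hf i j (Finset.ne_of_mem_erase hj).symm).1 R g hg
  · rw [regEval_eq, map_prod]
    exact Finset.prod_eq_zero (Finset.mem_erase.2 ⟨hij.symm, Finset.mem_univ j⟩)
      ((hf i j hij).2 R g hg)

section

variable {R : Type} [CommRing R] [Algebra ℚ R]

theorem one_mem_iso : (1 : GL (Fin d) R) ∈ V.iso R := by
  intro v w
  rw [Units.val_one, Matrix.one_mulVec, Matrix.one_mulVec]

theorem mul_mem_iso {g h : GL (Fin d) R} (hg : g ∈ V.iso R) (hh : h ∈ V.iso R) :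
    g * h ∈ V.iso R := by
  intro v w
  rw [Units.val_mul, ← Matrix.mulVec_mulVec, ← Matrix.mulVec_mulVec, hg, hh]

theorem inv_mem_iso {g : GL (Fin d) R} (hg : g ∈ V.iso R) : g⁻¹ ∈ V.iso R := by
  intro v w
  rw [← hg, Matrix.mulVec_mulVec, Matrix.mulVec_mulVec, ← Units.val_mul, mul_inv_cancel,
    Units.val_one, Matrix.one_mulVec, Matrix.one_mulVec]

theorem one_mem_twistedCentralizer : (1 : GL (Fin d) R) ∈ V.twistedCentralizer D 1 R :=
  ⟨V.one_mem_iso, fun β => by simp⟩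

variable {D}

theorem mul_mem_twistedCentralizer {a b : D ≃ₐ[ℚ] D} {g h : GL (Fin d) R}
    (hg : g ∈ V.twistedCentralizer D a R) (hh : h ∈ V.twistedCentralizer D b R) :
    g * h ∈ V.twistedCentralizer D (a * b) R := by
  refine ⟨V.mul_mem_iso hg.1 hh.1, fun β => ?_⟩
  rw [AlgEquiv.mul_apply, ← hg.2, ← hh.2, _root_.mul_inv_rev, Units.val_mul, Units.val_mul]
  simp only [mul_assoc]

theorem inv_mem_twistedCentralizer {a : D ≃ₐ[ℚ] D} {g : GL (Fin d) R}
    (hg : g ∈ V.twistedCentralizer D a R) : g⁻¹ ∈ V.twistedCentralizer D a⁻¹ R := by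
  refine ⟨V.inv_mem_iso hg.1, fun β => ?_⟩
  have h := hg.2 (a⁻¹ β)
  rw [show a (a⁻¹ β) = β from a.apply_symm_apply β] at h
  rw [← h, inv_inv]
  simp only [← mul_assoc, Units.inv_mul, one_mul]
  rw [mul_assoc, Units.inv_mul, mul_one]

end

theorem twistedCentralizer_one : V.twistedCentralizer D 1 = V.centralizer D := by
  funext R _ _
  ext g
  refine and_congr_right fun _ => ⟨fun h β hβ => ?_, fun h β => ?_⟩
  · have := h ⟨β, hβ⟩
    rw [AlgEquiv.one_apply] at this
    change _ = β.map (algebraMap ℚ R) at this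
    conv_rhs => rw [← this, mul_assoc, Units.inv_mul, mul_one]
  · rw [h β β.2, mul_assoc, Units.mul_inv, mul_one, AlgEquiv.one_apply]

variable {D} {F Fbar : Type*} [Field F] [Field Fbar] [Algebra F Fbar]
  (ρe : (Fbar ≃ₐ[F] Fbar) →* (D ≃ₐ[ℚ] D)) (K : IntermediateField F Fbar)

theorem twistedLefschetz_eq_union : V.twistedLefschetz ρe K =
    union fun a : K.fixingSubgroup.map ρe => V.twistedCentralizer D a :=
  union_comp_surjective (fun a : K.fixingSubgroup.map ρe => V.twistedCentralizer D a)
    (p := fun σ : K.fixingSubgroup => ⟨ρe σ, Subgroup.mem_map_of_mem ρe σ.2⟩)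
    (by rintro ⟨_, σ, hσ, rfl⟩; exact ⟨⟨σ, hσ⟩, rfl⟩)

theorem twistedLefschetz_contained_iso : Contained (V.twistedLefschetz ρe K) V.iso :=
  union_contained V.isClosedSubscheme_iso fun _ _ _ _ _ hg => hg.1

variable [Finite (K.fixingSubgroup.map ρe)]

theorem exists_separates_twistedCentralizer : ∃ e : K.fixingSubgroup.map ρe → CoordPoly ℚ d,
    Separates e (fun a => conjugationLocus D a.1) ∧
    Separates e fun a => V.twistedCentralizer D a := by
  obtain ⟨e, he⟩ := exists_separates_conjugationLocus D
    (fun a : K.fixingSubgroup.map ρe => (a : D ≃ₐ[ℚ] D)) Subtype.val_injective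
  exact ⟨e, he, he.mono fun _ _ _ _ _ hg => hg.2⟩

theorem isAlgSubgroup_twistedLefschetz : IsAlgSubgroup (V.twistedLefschetz ρe K) := by
  cases nonempty_fintype (K.fixingSubgroup.map ρe)
  obtain ⟨e, -, he⟩ := V.exists_separates_twistedCentralizer ρe K
  rw [twistedLefschetz_eq_union]
  exact he.isAlgSubgroup_union (fun a => V.isClosedSubscheme_twistedCentralizer D a)
    (fun _ _ _ => V.one_mem_twistedCentralizer D)
    (fun _ _ _ _ _ _ hg _ hh => V.mul_mem_twistedCentralizer hg hh)
    (fun _ _ _ _ _ hg => V.inv_mem_twistedCentralizer hg)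

theorem baseChange_twistedLefschetz (k : Type) [Field k] [Algebra ℚ k] :
    (V.twistedLefschetz ρe K).baseChange k =
      union fun a : K.fixingSubgroup.map ρe => (V.twistedCentralizer D a).baseChange k := by
  cases nonempty_fintype (K.fixingSubgroup.map ρe)
  obtain ⟨e, -, he⟩ := V.exists_separates_twistedCentralizer ρe K
  rw [twistedLefschetz_eq_union]
  exact he.baseChange_union (fun a => V.isClosedSubscheme_twistedCentralizer D a) k

end PolarizedHodge

/-! ### Comparison with the Zariski closure of a group of similitudes -/

namespace PolarizedHodge

open SubGL MvPolynomial Matrix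

variable {d : ℕ} {n : ℤ} (V : PolarizedHodge d n) {D : Subalgebra ℚ (Matrix (Fin d) (Fin d) ℚ)}
  {F Fbar : Type*} [Field F] [Field Fbar] [Algebra F Fbar]
  (ρe : (Fbar ≃ₐ[F] Fbar) →* (D ≃ₐ[ℚ] D)) (K : IntermediateField F Fbar)
  {k : Type} [Field k] [Algebra ℚ k]

/-- A group acting on `D` through the automorphisms `ρe σ`, `σ ∈ G_K`, has its Zariski closure in
the disjoint union of the corresponding conjugation loci. -/
theorem zariskiClosure_inter_iso_contained [Finite (K.fixingSubgroup.map ρe)]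
    {S : Set (GL (Fin d) k)}
    (hS : ∀ s ∈ S, ∃ a ∈ K.fixingSubgroup.map ρe, s ∈ (conjugationLocus D a).baseChange k k) :
    Contained (inter (zariskiClosure S) (V.iso.baseChange k))
      ((V.twistedLefschetz ρe K).baseChange k) := by
  cases nonempty_fintype (K.fixingSubgroup.map ρe)
  obtain ⟨e, he, -⟩ := V.exists_separates_twistedCentralizer ρe K
  rw [baseChange_twistedLefschetz]
  intro R _ _ g hg
  have h := (he.baseChange k).inter_union_contained
    (fun a => (isClosedSubscheme_conjugationLocus D a.1).baseChange k)
    (V.isClosedSubscheme_iso.baseChange k) R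
    (show g ∈ _ from ⟨fun f hf => hg.1 f fun s hs => ?_, hg.2⟩)
  · simp_rw [twistedCentralizer_eq]
    exact h
  · obtain ⟨a, ha, hsa⟩ := hS s hs
    exact hf ⟨a, ha⟩ k s hsa

theorem scalar_mul_mem_twistedCentralizer {R : Type} [CommRing R] [Algebra ℚ R]
    {a : D ≃ₐ[ℚ] D} {g : GL (Fin d) R} (hg : g ∈ conjugationLocus D a R) {c : R}
    (hc : (g : Matrix (Fin d) (Fin d) R)ᵀ * V.psi.map (algebraMap ℚ R) *
      (g : Matrix (Fin d) (Fin d) R) = c • V.psi.map (algebraMap ℚ R))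
    (t : Rˣ) (ht : (t : R) * t * c = 1) :
    GeneralLinearGroup.scalar (Fin d) t * g ∈ V.twistedCentralizer D a R := by
  have hcoe : ∀ t : Rˣ, ((GeneralLinearGroup.scalar (Fin d) t : GL (Fin d) R) :
      Matrix (Fin d) (Fin d) R) = (t : R) • 1 := fun t => by
    rw [GeneralLinearGroup.coe_scalar, Matrix.scalar_apply, Matrix.smul_one_eq_diagonal]
  refine ⟨(V.mem_iso_iff _).2 ?_, fun β => ?_⟩
  · rw [Units.val_mul, hcoe, Matrix.smul_mul, one_mul, Matrix.transpose_smul]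
    simp only [Matrix.smul_mul, Matrix.mul_smul, hc, smul_smul]
    rw [← mul_assoc, ht, one_smul]
  · rw [← hg β, _root_.mul_inv_rev, Units.val_mul, Units.val_mul, ← map_inv, hcoe, hcoe]
    simp only [Matrix.smul_mul, Matrix.mul_smul, smul_smul, one_mul, mul_one]
    rw [Units.inv_mul, one_smul]

/-- If the Zariski closure of a group `Γ` contains the homotheties and the centralizer of `D` in
`Iso`, and some similitude in `Γ` acts on `D` through `a`, then the closure contains the whole
twist of the centralizer by `a`: after a quadratic extension, the similitude is a homothety times
a point of this twist. -/
theorem twistedCentralizer_contained_zariskiClosure (Γ : Subgroup (GL (Fin d) k))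
    (hC : Contained ((V.centralizer D).baseChange k) (zariskiClosure (Γ : Set (GL (Fin d) k))))
    (hscal : ∀ (R : Type) [CommRing R] [Algebra k R] (s : Rˣ),
      GeneralLinearGroup.scalar (Fin d) s ∈ zariskiClosure (Γ : Set (GL (Fin d) k)) R)
    {a : D ≃ₐ[ℚ] D} {γ : GL (Fin d) k} (hγ : γ ∈ Γ)
    (hγa : γ ∈ (conjugationLocus D a).baseChange k k) {c : k} (hc : c ≠ 0)
    (hγc : (γ : Matrix (Fin d) (Fin d) k)ᵀ * V.psi.map (algebraMap ℚ k) *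
      (γ : Matrix (Fin d) (Fin d) k) = c • V.psi.map (algebraMap ℚ k)) :
    Contained ((V.twistedCentralizer D a).baseChange k)
      (zariskiClosure (Γ : Set (GL (Fin d) k))) := by
  intro R _ _ h hh
  let R' := QuadraticAlgebra R (algebraMap k R c⁻¹) 0
  have hR' : (algebraMap R R').comp (algebraMap k R) = algebraMap k R' :=
    (IsScalarTower.algebraMap_eq k R R').symm
  have hω : (QuadraticAlgebra.omega : R') * QuadraticAlgebra.omega * algebraMap k R' c = 1 := by
    rw [QuadraticAlgebra.omega_mul_omega_eq_mk, ← QuadraticAlgebra.algebraMap_eq, ← hR',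
      RingHom.comp_apply, ← map_mul, ← map_mul, inv_mul_cancel₀ hc, map_one, map_one]
  let t : R'ˣ := Units.mkOfMulEqOne QuadraticAlgebra.omega
    (QuadraticAlgebra.omega * algebraMap k R' c) (by rw [← mul_assoc, hω])
  have hcl : IsClosedSubscheme (zariskiClosure (Γ : Set (GL (Fin d) k))) :=
    isClosedSubscheme_zeroLocus _
  refine hcl.mem_of_map_mem (algebraMap R R') hR' QuadraticAlgebra.algebraMap_injective ?_
  let g := GeneralLinearGroup.scalar (Fin d) t * GeneralLinearGroup.map (algebraMap k R') γ
  have hg : g ∈ zariskiClosure (Γ : Set (GL (Fin d) k)) R' :=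
    mul_mem_zariskiClosure Γ (hscal _ t) (mem_zariskiClosure_of_mem hγ)
  have hga : g ∈ (V.twistedCentralizer D a).baseChange k R' := by
    let _ : Algebra ℚ R' := Algebra.compHom R' (algebraMap ℚ k)
    refine V.scalar_mul_mem_twistedCentralizer (c := algebraMap k R' c) ?_ ?_ t ?_
    · exact ((isClosedSubscheme_conjugationLocus D a).baseChange k).map_mem (algebraMap k R')
        (RingHom.comp_id _) hγa
    · have := congrArg (fun M => M.map (algebraMap k R')) hγc
      have hQ : ⇑(algebraMap ℚ R') = algebraMap k R' ∘ algebraMap ℚ k := rfl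
      rw [hQ]
      simpa [Matrix.map_mul, Matrix.transpose_map, Matrix.map_map, Matrix.map_smul'] using this
    · exact hω
  have hone : GeneralLinearGroup.map (algebraMap R R') h * g⁻¹ ∈
      (V.centralizer D).baseChange k R' := by
    rw [← twistedCentralizer_one]
    let _ : Algebra ℚ R' := Algebra.compHom R' (algebraMap ℚ k)
    have h1 : GeneralLinearGroup.map (algebraMap R R') h ∈
        (V.twistedCentralizer D a).baseChange k R' :=
      ((V.isClosedSubscheme_twistedCentralizer D a).baseChange k).map_mem _ hR' hh
    have := V.mul_mem_twistedCentralizer (R := R') h1 (V.inv_mem_twistedCentralizer (R := R') hga)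
    rwa [mul_inv_cancel] at this
  have := mul_mem_zariskiClosure Γ (hC R' hone) hg
  rwa [inv_mul_cancel_right] at this

end PolarizedHodge

/-! ### Subgroups of finite index and the identity component -/

namespace SubGL

open MvPolynomial Matrix

variable {k : Type} [Field k] {d : ℕ}

/-- The ideal of regular functions that vanish on a set of points. -/
noncomputable def vanishingIdealOf (S : Set (GL (Fin d) k)) : Ideal (CoordPoly k d) where
  carrier := {f | ∀ g ∈ S, regEval g f = 0}
  zero_mem' g _ := map_zero (evalHom g)
  add_mem' {f f'} hf hf' g hg := by rw [regEval_eq, map_add]; simp [← regEval_eq, hf g hg, hf' g hg]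
  smul_mem' c f hf g hg := by
    rw [regEval_eq, smul_eq_mul, map_mul]; simp [← regEval_eq, hf g hg]

/-- A quotient of the polynomial ring by an ideal containing the functions that vanish on some
set of points carries a universal point of `GL_d`. -/
theorem exists_universal_point {S : Set (GL (Fin d) k)} {I : Ideal (CoordPoly k d)}
    (hI : vanishingIdealOf S ≤ I) :
    ∃ g : GL (Fin d) (CoordPoly k d ⧸ I), ∀ f, regEval g f = Ideal.Quotient.mk I f := by
  have h : ∀ M : Matrix (Fin d) (Fin d) (CoordPoly k d),
      (∀ s ∈ S, M.map (evalHom s) = 1) → M.map (Ideal.Quotient.mk I) = 1 := by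
    intro M hM
    have : (M - 1).map (Ideal.Quotient.mk I) = 0 := by
      ext i j
      rw [Matrix.map_apply, Matrix.zero_apply, Ideal.Quotient.eq_zero_iff_mem]
      refine hI fun s hs => ?_
      have h1 : (M - 1).map (evalHom s) = 0 := by
        rw [Matrix.map_sub _ (map_sub _), hM s hs, Matrix.map_one _ (map_zero _) (map_one _),
          sub_self]
      exact congrFun (congrFun h1 i) j
    rwa [Matrix.map_sub _ (map_sub _), Matrix.map_one _ (map_zero _) (map_one _),
      sub_eq_zero] at this
  let g : GL (Fin d) (CoordPoly k d ⧸ I) :=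
    { val := (genericMatrix k d).map (Ideal.Quotient.mk I)
      inv := (genericInverse k d).map (Ideal.Quotient.mk I)
      val_inv := by
        rw [← Matrix.map_mul]
        refine h _ fun s _ => ?_
        rw [Matrix.map_mul, map_genericMatrix, map_genericInverse, Units.mul_inv]
      inv_val := by
        rw [← Matrix.map_mul]
        refine h _ fun s _ => ?_
        rw [Matrix.map_mul, map_genericMatrix, map_genericInverse, Units.inv_mul] }
  refine ⟨g, fun f => ?_⟩
  have : evalHom g = Ideal.Quotient.mkₐ k I := by
    refine MvPolynomial.algHom_ext fun ⟨b, i, j⟩ => ?_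
    cases b <;> simp only [evalHom, aeval_X] <;> rfl
  rw [regEval_eq, this]
  rfl

/-- A closed subgroup and a coset of it through a rational point outside it are separated by a
regular function: otherwise the two subschemes would have a common point over some nonzero
algebra, and the quotient of this point by itself would put the coset representative into the
subgroup. -/
theorem exists_separating_coset (Γ : Subgroup (GL (Fin d) k)) {γ : GL (Fin d) k}
    (hγ : γ ∉ zariskiClosure (Γ : Set (GL (Fin d) k)) k) :
    ∃ e : CoordPoly k d, (∀ g ∈ Γ, regEval g e = 1) ∧ ∀ g ∈ Γ, regEval (g * γ) e = 0 := by
  let T : Set (GL (Fin d) k) := {x | ∃ g ∈ Γ, x = g * γ}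
  let I := vanishingIdealOf (Γ : Set (GL (Fin d) k)) ⊔ vanishingIdealOf T
  have hI : I = ⊤ := by
    by_contra hne
    let Q := CoordPoly k d ⧸ I
    have : Nontrivial Q := Ideal.Quotient.nontrivial_iff.2 hne
    obtain ⟨x, hx⟩ := exists_universal_point (S := (Γ : Set (GL (Fin d) k))) (I := I) le_sup_left
    have hxΓ : x ∈ zariskiClosure (Γ : Set (GL (Fin d) k)) Q := fun f hf => by
      rw [hx, Ideal.Quotient.eq_zero_iff_mem]
      exact Ideal.mem_sup_left hf
    have hxT : x ∈ zariskiClosure T Q := fun f hf => by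
      rw [hx, Ideal.Quotient.eq_zero_iff_mem]
      exact Ideal.mem_sup_right hf
    apply hγ
    have hcl : IsClosedSubscheme (zariskiClosure (Γ : Set (GL (Fin d) k))) :=
      isClosedSubscheme_zeroLocus _
    refine hcl.mem_of_map_mem (algebraMap k Q) (RingHom.comp_id _) (algebraMap k Q).injective ?_
    -- Translation by `γ⁻¹` maps `Γ γ` into `Γ`, hence the closure of `Γ γ` into that of `Γ`.
    have hxγ : x * (GeneralLinearGroup.map (algebraMap k Q) γ)⁻¹ ∈
        zariskiClosure (Γ : Set (GL (Fin d) k)) Q := by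
      intro f hf
      refine eq_zero_of_mem_zariskiClosure hxT
        (F := fun y => regEval (y * (GeneralLinearGroup.map (algebraMap k Q) γ)⁻¹) f)
        (regEval_comp_mem_regularFunctions _ (coords_mul_mem_regularFunctions _) f) ?_
      rintro _ ⟨g, hg, rfl⟩
      rw [map_mul, mul_inv_cancel_right, regEval_map _ (RingHom.comp_id _), hf g hg, map_zero]
    have := mul_mem_zariskiClosure Γ
      (mul_inv_mem_zariskiClosure Γ hxγ (one_mem_zariskiClosure Γ)) hxΓ
    simpa using this
  have h1 : (1 : CoordPoly k d) ∈ I := by rw [hI]; trivial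
  obtain ⟨a, ha, b, hb, hab⟩ := Submodule.mem_sup.1 h1
  refine ⟨b, fun g hg => ?_, fun g hg => hb _ ⟨g, hg, rfl⟩⟩
  have h2 := congrArg (evalHom g) hab
  rw [map_add, map_one, ← regEval_eq, ha g hg, zero_add] at h2
  exact h2

/-- The identity component of the closure of a group is contained in the closure of every subgroup
of finite index: this closure is separated from the cosets different from it. -/
theorem idComp_zariskiClosure_contained (Γ Γ' : Subgroup (GL (Fin d) k))
    (hfin : Γ'.relIndex Γ ≠ 0) :
    Contained (idComp (zariskiClosure (Γ : Set (GL (Fin d) k))))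
      (zariskiClosure (Γ' : Set (GL (Fin d) k))) := by
  classical
  let Z := zariskiClosure (Γ' : Set (GL (Fin d) k))
  have : (Γ'.subgroupOf Γ).FiniteIndex := ⟨hfin⟩
  have : Finite (Γ ⧸ Γ'.subgroupOf Γ) := Subgroup.finite_quotient_of_finiteIndex
  cases nonempty_fintype (Γ ⧸ Γ'.subgroupOf Γ)
  -- Inverses of representatives of the left cosets represent the right cosets `Γ' γ`.
  let r : Γ ⧸ Γ'.subgroupOf Γ → GL (Fin d) k := fun q => ((q.out : Γ) : GL (Fin d) k)⁻¹
  have hr : ∀ γ ∈ Γ, ∃ q, ∃ h ∈ Γ', γ = h * r q := by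
    intro γ hγ
    refine ⟨QuotientGroup.mk ⟨γ, hγ⟩⁻¹, _, ?_, (inv_mul_cancel_right γ _).symm⟩
    obtain ⟨h, hh⟩ := QuotientGroup.mk_out_eq_mul (Γ'.subgroupOf Γ) (⟨γ, hγ⟩⁻¹ : Γ)
    rw [inv_inv, hh]
    simpa using Subgroup.mem_subgroupOf.1 h.2
  have hsep : ∀ q, ∃ e : CoordPoly k d, (∀ g ∈ Γ', regEval g e = 1) ∧
      (r q ∉ Z k → ∀ g ∈ Γ', regEval (g * r q) e = 0) := by
    intro q
    by_cases hq : r q ∈ Z k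
    · exact ⟨1, fun g _ => map_one (evalHom g), fun h => (h hq).elim⟩
    · obtain ⟨e, he1, he0⟩ := exists_separating_coset Γ' hq
      exact ⟨e, he1, fun _ => he0⟩
  choose e he1 he0 using hsep
  let E : CoordPoly k d := ∏ q, e q
  have hE1 : ∀ g ∈ Z k, regEval g E = 1 := by
    intro g hg
    have := hg (E - 1) fun s hs => by
      rw [regEval_eq, map_sub, map_prod, map_one, sub_eq_zero]
      exact Finset.prod_eq_one fun q _ => he1 q s hs
    rwa [regEval_eq, map_sub, map_one, sub_eq_zero] at this
  have hE : ∀ γ ∈ Γ, γ ∈ Z k ∨ regEval γ E = 0 := by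
    intro γ hγ
    obtain ⟨q, h, hh, rfl⟩ := hr γ hγ
    by_cases hq : r q ∈ Z k
    · exact Or.inl (mul_mem_zariskiClosure Γ' (fun f hf => hf h hh) hq)
    · right
      rw [regEval_eq, map_prod]
      exact Finset.prod_eq_zero (Finset.mem_univ q) (he0 q hq h hh)
  intro R _ _ g hg f hf
  have hgE : regEval g E = 1 := by
    refine hg.2 E (fun A _ _ x hx => ?_) (hE1 1 (one_mem_zariskiClosure Γ'))
    have := hx (E * E - E) fun γ hγ => by
      rw [regEval_eq, map_sub, map_mul, ← regEval_eq]
      rcases hE γ hγ with h | h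
      · rw [hE1 γ h, mul_one, sub_self]
      · rw [h, mul_zero, sub_self]
    rwa [regEval_eq, map_sub, map_mul, sub_eq_zero] at this
  have := hg.1 (E * f) fun γ hγ => by
    rw [regEval_eq, map_mul]
    rcases hE γ hγ with h | h
    · exact mul_eq_zero_of_right _ (h f hf)
    · exact mul_eq_zero_of_left h _
  rwa [regEval_eq, map_mul, ← regEval_eq, ← regEval_eq, hgE, one_mul] at this

end SubGL

/-! ### Operators defined by the Hodge decomposition -/

namespace PolarizedHodge

open SubGL Matrix

variable {d : ℕ} {n : ℤ} (V : PolarizedHodge d n)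

theorem hdg_induction {P : (Fin d → ℂ) → Prop} (h0 : P 0) (hadd : ∀ v w, P v → P w → P (v + w))
    (h : ∀ p, ∀ v ∈ V.hdg p, P v) (v : Fin d → ℂ) : P v :=
  Submodule.iSup_induction V.hdg (motive := P)
    (V.isInternal.submodule_iSup_eq_top ▸ Submodule.mem_top) h h0 hadd

theorem eq_of_mulVec_hdg {M N : Matrix (Fin d) (Fin d) ℂ}
    (h : ∀ p, ∀ v ∈ V.hdg p, M *ᵥ v = N *ᵥ v) : M = N := by
  refine Matrix.mulVec_injective (funext fun v => ?_)
  induction v using V.hdg_induction with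
  | h0 => simp
  | hadd v w hv hw => rw [Matrix.mulVec_add, Matrix.mulVec_add, hv, hw]
  | h p v hv => exact h p v hv

theorem exists_matrix_hdg (c : ℤ → ℂ) :
    ∃ M : Matrix (Fin d) (Fin d) ℂ, ∀ p, ∀ v ∈ V.hdg p, M *ᵥ v = c p • v := by
  let e := LinearEquiv.ofBijective (DirectSum.coeLinearMap V.hdg) V.isInternal
  let f : (Fin d → ℂ) →ₗ[ℂ] (Fin d → ℂ) := DirectSum.coeLinearMap V.hdg ∘ₗ
    DirectSum.lmap (fun p => c p • LinearMap.id) ∘ₗ e.symm.toLinearMap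
  refine ⟨LinearMap.toMatrix' f, fun p v hv => ?_⟩
  have he : e.symm v = DirectSum.lof ℂ ℤ (fun p => V.hdg p) p ⟨v, hv⟩ := by
    rw [LinearEquiv.symm_apply_eq]
    exact (DirectSum.coeLinearMap_lof V.hdg p ⟨v, hv⟩).symm
  rw [LinearMap.toMatrix'_mulVec]
  change DirectSum.coeLinearMap V.hdg (DirectSum.lmap _ (e.symm v)) = _
  rw [he, DirectSum.lmap_lof, DirectSum.coeLinearMap_lof]
  rfl

/-- The operator which acts on `V^{p, n - p}` as the scalar `c p`. -/
theorem exists_gl_hdg (c : ℤ → ℂˣ) : ∃ g : GL (Fin d) ℂ, ∀ p, ∀ v ∈ V.hdg p,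
    (g : Matrix (Fin d) (Fin d) ℂ) *ᵥ v = (c p : ℂ) • v := by
  obtain ⟨M, hM⟩ := V.exists_matrix_hdg fun p => c p
  obtain ⟨N, hN⟩ := V.exists_matrix_hdg fun p => ((c p)⁻¹ : ℂˣ)
  refine ⟨⟨M, N, V.eq_of_mulVec_hdg fun p v hv => ?_, V.eq_of_mulVec_hdg fun p v hv => ?_⟩, hM⟩
  · rw [← Matrix.mulVec_mulVec, hN p v hv, Matrix.mulVec_smul, hM p v hv, smul_smul,
      Units.inv_mul, one_smul, Matrix.one_mulVec]
  · rw [← Matrix.mulVec_mulVec, hM p v hv, Matrix.mulVec_smul, hN p v hv, smul_smul,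
      Units.mul_inv, one_smul, Matrix.one_mulVec]

theorem map_star_mulVec (M : Matrix (Fin d) (Fin d) ℂ) (v : Fin d → ℂ) :
    M.map (starRingEnd ℂ) *ᵥ star v = star (M *ᵥ v) :=
  funext fun i => (RingHom.map_mulVec (starRingEnd ℂ) M v i).symm

/-! ### Homotheties in the Mumford-Tate group -/

theorem coe_scalar_mulVec {R : Type} [CommRing R] (s : Rˣ) (v : Fin d → R) :
    ((GeneralLinearGroup.scalar (Fin d) s : GL (Fin d) R) : Matrix (Fin d) (Fin d) R) *ᵥ v =
      (s : R) • v := by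
  rw [GeneralLinearGroup.coe_scalar, Matrix.scalar_apply, ← Matrix.smul_one_eq_diagonal,
    Matrix.smul_mulVec, Matrix.one_mulVec]

/-- The product of `μ_∞(z)` and its complex conjugate is the homothety by `z ^ (-n)`. -/
theorem scalar_zpow_mem {X : SubGL ℚ d} (hX : IsAlgSubgroup X) (hμ : V.muImage ⊆ X ℂ) (z : ℂˣ) :
    GeneralLinearGroup.scalar (Fin d) (z ^ (-n)) ∈ X ℂ := by
  obtain ⟨g, hg⟩ := V.exists_gl_hdg fun p => z ^ (-p)
  obtain ⟨h, hh⟩ := V.exists_gl_hdg fun p => (star z) ^ (-p)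
  have hgX : g ∈ X ℂ := hμ ⟨z, fun p v hv => by rw [hg p v hv, Units.val_zpow_eq_zpow_val]⟩
  have hhX : h ∈ X ℂ :=
    hμ ⟨star z, fun p v hv => by rw [hh p v hv, Units.val_zpow_eq_zpow_val]⟩
  have hcX : GeneralLinearGroup.map (starRingEnd ℂ) h ∈ X ℂ :=
    IsClosedSubscheme.map_mem hX.closed _ (Subsingleton.elim _ _) hhX
  convert! hX.mul_mem ℂ g hgX _ hcX using 1
  refine Units.ext (V.eq_of_mulVec_hdg fun p v hv => ?_)
  have h1 : (GeneralLinearGroup.map (starRingEnd ℂ) h : Matrix (Fin d) (Fin d) ℂ) *ᵥ v =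
      ((z ^ (-(n - p)) : ℂˣ) : ℂ) • v := by
    have := map_star_mulVec (h : Matrix (Fin d) (Fin d) ℂ) (star v)
    rw [star_star, hh _ _ (V.conj_mem p v hv), star_smul, star_star] at this
    refine this.trans ?_
    congr 1
    simp
  rw [coe_scalar_mulVec, Units.val_mul, ← Matrix.mulVec_mulVec, h1, Matrix.mulVec_smul,
    hg p v hv, smul_smul, ← Units.val_mul, ← _root_.zpow_add]
  congr 4
  ring

open scoped LaurentPolynomial in
/-- A regular function that vanishes at all rational homotheties vanishes at the generic one. -/
theorem _root_.SubGL.regEval_scalar_eq_zero {f : CoordPoly ℚ d}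
    (hf : ∀ w : ℚˣ, regEval (GeneralLinearGroup.scalar (Fin d) w) f = 0)
    {R : Type} [CommRing R] [Algebra ℚ R] (s : Rˣ) :
    regEval (GeneralLinearGroup.scalar (Fin d) s) f = 0 := by
  let T : ℚ[T;T⁻¹]ˣ := ⟨LaurentPolynomial.T 1, LaurentPolynomial.T (-1),
    by rw [← LaurentPolynomial.T_add]; simp, by rw [← LaurentPolynomial.T_add]; simp⟩
  have spec : ∀ (A : Type) [CommRing A] [Algebra ℚ A] (u : Aˣ),
      regEval (GeneralLinearGroup.scalar (Fin d) u) f =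
        LaurentPolynomial.eval₂ (algebraMap ℚ A) u
          (regEval (GeneralLinearGroup.scalar (Fin d) T) f) := by
    intro A _ _ u
    rw [← regEval_map _ (Subsingleton.elim _ _), GeneralLinearGroup.map_scalar]
    congr 2
    refine Units.ext ?_
    have h1 := LaurentPolynomial.eval₂_T (algebraMap ℚ A) u 1
    rw [zpow_one] at h1
    exact h1.symm
  have hzero : regEval (GeneralLinearGroup.scalar (Fin d) T) f = 0 := by
    set φ := regEval (GeneralLinearGroup.scalar (Fin d) T) f with hφ
    obtain ⟨m, q, hq⟩ := LaurentPolynomial.exists_T_pow φ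
    have hq0 : q = 0 := by
      refine Polynomial.eq_zero_of_infinite_isRoot q ?_
      refine Set.Infinite.mono (s := {0}ᶜ) (fun w hw => ?_) (Set.finite_singleton 0).infinite_compl
      have h1 := congrArg (LaurentPolynomial.eval₂ (algebraMap ℚ ℚ) (Units.mk0 w hw)) hq
      rw [map_mul, ← spec ℚ (Units.mk0 w hw), hf, zero_mul, LaurentPolynomial.eval₂_toLaurent] at h1
      exact h1
    rw [hq0, map_zero] at hq
    exact ((LaurentPolynomial.isUnit_T (R := ℚ) m).mul_left_eq_zero).1 hq.symm
  rw [spec R s, hzero, map_zero]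

/-- The Mumford-Tate group of a Hodge structure of nonzero weight contains the homotheties. -/
theorem scalar_mem_mumfordTate (hn : n ≠ 0) {R : Type} [CommRing R] [Algebra ℚ R] (s : Rˣ) :
    GeneralLinearGroup.scalar (Fin d) s ∈ V.mumfordTate R := by
  intro X hX _ hμ
  obtain ⟨S, hS⟩ := hX.closed
  have hQ : ∀ w : ℚˣ, GeneralLinearGroup.scalar (Fin d) w ∈ X ℚ := by
    intro w
    obtain ⟨z, hz⟩ : ∃ z : ℂˣ, z ^ (-n) = Units.map (algebraMap ℚ ℂ : ℚ →* ℂ) w := by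
      set u : ℂˣ := Units.map (algebraMap ℚ ℂ : ℚ →* ℂ) w
      have hpos : 0 < n.natAbs := Int.natAbs_pos.2 hn
      obtain ⟨y, hy⟩ := IsAlgClosed.exists_pow_nat_eq (u : ℂ) hpos
      have hy0 : y ≠ 0 := by
        rintro rfl
        rw [zero_pow hpos.ne'] at hy
        exact u.ne_zero hy.symm
      have hyu : (Units.mk0 y hy0) ^ n.natAbs = u := Units.ext (by simpa using hy)
      rcases Int.natAbs_eq n with h | h
      · exact ⟨(Units.mk0 y hy0)⁻¹, by rw [h, _root_.inv_zpow', neg_neg, zpow_natCast, hyu]⟩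
      · exact ⟨Units.mk0 y hy0, by rw [h, neg_neg, zpow_natCast, hyu]⟩
    have h1 := V.scalar_zpow_mem hX hμ z
    rw [hz] at h1
    refine IsClosedSubscheme.mem_of_map_mem hX.closed (algebraMap ℚ ℂ) (RingHom.comp_id _)
      (algebraMap ℚ ℂ).injective ?_
    rw [GeneralLinearGroup.map_scalar]
    exact h1
  rw [hS] at hQ ⊢
  exact fun f hf => regEval_scalar_eq_zero (fun w => hQ w f hf) s

end PolarizedHodge

/-! ### Kolchin's theorem in characteristic zero -/

section Kolchin

open Polynomial

variable {k : Type*} [Field k] {E : Type*} [AddCommGroup E] [Module k E] [FiniteDimensional k E]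

/-- If all powers of `z` have trace zero, then `1` is not an eigenvalue of `z`: the projection to
the generalized eigenspaces of the nonzero eigenvalues is a polynomial in `z` without constant
term, so it is an idempotent of trace zero. -/
theorem Module.End.eq_zero_of_trace_pow_eq_zero [CharZero k] {z : Module.End k E}
    (hz : ∀ i : ℕ, LinearMap.trace k E (z ^ (i + 1)) = 0) {v : E} (hv : z v = v) : v = 0 := by
  by_contra hv0
  have heig : ∀ p : k[X], aeval z p v = p.eval 1 • v := fun p =>
    Module.End.aeval_apply_of_hasEigenvector
      ⟨Module.End.mem_eigenspace_iff.2 (by rw [hv, one_smul]), hv0⟩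
  have hm0 : minpoly k z ≠ 0 := minpoly.ne_zero (Algebra.IsIntegral.isIntegral z)
  obtain ⟨q, hq, hndvd⟩ := exists_eq_pow_rootMultiplicity_mul_and_not_dvd (minpoly k z) hm0 0
  set r := rootMultiplicity 0 (minpoly k z)
  rw [map_zero, sub_zero] at hq hndvd
  -- The exponent `r + 1` instead of `r` makes the constant term vanish also when `z` is invertible.
  have hcop : IsCoprime (X ^ (r + 1)) q :=
    ((irreducible_X.coprime_iff_not_dvd).2 hndvd).pow_left
  obtain ⟨a, b, hab⟩ := hcop
  have htr : ∀ p : k[X], LinearMap.trace k E (aeval z (p * X)) = 0 := by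
    intro p
    induction p using Polynomial.induction_on' with
    | add p q hp hq => rw [add_mul, map_add, map_add, hp, hq, add_zero]
    | monomial i c =>
      rw [monomial_mul_X, aeval_monomial, ← Algebra.smul_def, map_smul, hz, smul_zero]
  have hidem : IsIdempotentElem (aeval z (a * X ^ (r + 1))) := by
    rw [IsIdempotentElem, ← map_mul, ← sub_eq_zero, ← map_sub]
    have : a * X ^ (r + 1) * (a * X ^ (r + 1)) - a * X ^ (r + 1) =
        -(a * b * X) * minpoly k z := by
      rw [hq]
      linear_combination (a * X ^ (r + 1)) * hab
    rw [this, map_mul, minpoly.aeval, mul_zero]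
  have hzero : aeval z (a * X ^ (r + 1)) = 0 := by
    refine (LinearMap.IsIdempotentElem.trace_eq_zero_iff hidem).1 ?_
    rw [pow_succ, ← mul_assoc]
    exact htr _
  have hq1 : q.eval 1 = 0 := by
    have h1 := heig (minpoly k z)
    rw [minpoly.aeval, LinearMap.zero_apply, eq_comm, smul_eq_zero, hq] at h1
    simpa [hv0] using h1
  have h2 := heig (a * X ^ (r + 1))
  have h3 := congrArg (eval 1) hab
  rw [eval_add, eval_mul (p := b), hq1, mul_zero, add_zero, eval_one] at h3
  rw [hzero, LinearMap.zero_apply, h3, one_smul] at h2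
  exact hv0 h2.symm

/-- A monoid of unipotent operators on an irreducible representation acts trivially. -/
theorem MonoidHom.apply_eq_one_of_unipotent_of_irreducible [CharZero k] {M : Type*} [Monoid M]
    (ρ : M →* Module.End k E) (hρ : ∀ m, IsNilpotent (ρ m - 1))
    (hirr : ∀ P : Submodule k E, (∀ m, ∀ v ∈ P, ρ m v ∈ P) → P = ⊥ ∨ P = ⊤) (m : M) :
    ρ m = 1 := by
  have htr : ∀ m, LinearMap.trace k E (ρ m) = LinearMap.trace k E 1 := fun m => by
    rw [← sub_eq_zero, ← map_sub]
    exact (LinearMap.isNilpotent_trace_of_isNilpotent (hρ m)).eq_zero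
  let B : Subalgebra k (Module.End k E) := Algebra.adjoin k (Set.range ρ)
  have hB : ∀ y ∈ B, y ∈ Submodule.span k (Set.range ρ) := by
    intro y hy
    have h1 : Set.range ρ = (MonoidHom.mrange ρ : Set (Module.End k E)) := rfl
    rwa [← Subalgebra.mem_toSubmodule, Algebra.adjoin_eq_span, h1, Submonoid.closure_eq,
      ← h1] at hy
  have hxB : ∀ y ∈ B, LinearMap.trace k E ((ρ m - 1) * y) = 0 := by
    intro y hy
    replace hy := hB y hy
    induction hy using Submodule.span_induction with
    | mem y h =>
      obtain ⟨m', rfl⟩ := h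
      rw [sub_mul, one_mul, ← map_mul, map_sub, htr, htr, sub_self]
    | zero => rw [mul_zero, map_zero]
    | add y z _ _ h h' => rw [mul_add, map_add, h, h', add_zero]
    | smul c y _ h => rw [mul_smul_comm, map_smul, h, smul_zero]
  have hx : ρ m - 1 ∈ B := sub_mem (Algebra.subset_adjoin ⟨m, rfl⟩) (one_mem B)
  rw [← sub_eq_zero]
  ext v
  by_contra hv
  rw [LinearMap.zero_apply] at hv
  let P : Submodule k E := (Subalgebra.toSubmodule B).map
    (LinearMap.applyₗ ((ρ m - 1) v) : Module.End k E →ₗ[k] E)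
  have hP : P = ⊤ := by
    refine (hirr P ?_).resolve_left ?_
    · rintro m' _ ⟨y, hy, rfl⟩
      exact ⟨ρ m' * y, B.mul_mem (Algebra.subset_adjoin ⟨m', rfl⟩) hy, rfl⟩
    · intro h
      have : (ρ m - 1) v ∈ P := ⟨1, one_mem B, rfl⟩
      rw [h, Submodule.mem_bot] at this
      exact hv this
  obtain ⟨y, hy, hyv⟩ : v ∈ P := hP ▸ Submodule.mem_top
  have hv0 : v = 0 := by
    refine Module.End.eq_zero_of_trace_pow_eq_zero (z := y * (ρ m - 1)) (fun i => ?_) hyv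
    rw [pow_succ, ← mul_assoc, LinearMap.trace_mul_comm]
    exact hxB _ (B.mul_mem (B.pow_mem (B.mul_mem hy hx) i) hy)
  exact hv (by rw [hv0, map_zero])

/-- **Kolchin's theorem**: a monoid of unipotent operators has a nonzero fixed vector. -/
theorem MonoidHom.exists_fixed_of_unipotent [CharZero k] [Nontrivial E] {M : Type*} [Monoid M]
    (ρ : M →* Module.End k E) (hρ : ∀ m, IsNilpotent (ρ m - 1)) :
    ∃ v : E, v ≠ 0 ∧ ∀ m, ρ m v = v := by
  induction hN : Module.finrank k E using Nat.strong_induction_on generalizing E with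
  | _ N ih =>
  by_cases hirr : ∀ P : Submodule k E, (∀ m, ∀ v ∈ P, ρ m v ∈ P) → P = ⊥ ∨ P = ⊤
  · obtain ⟨v, hv⟩ := exists_ne (0 : E)
    exact ⟨v, hv, fun m => by
      rw [ρ.apply_eq_one_of_unipotent_of_irreducible hρ hirr m, Module.End.one_apply]⟩
  · push Not at hirr
    obtain ⟨P, hP, hbot, htop⟩ := hirr
    have : Nontrivial P := Submodule.nontrivial_iff_ne_bot.2 hbot
    let ρ' : M →* Module.End k P :=
      { toFun := fun m => (ρ m).restrict (hP m)
        map_one' := by ext v; simp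
        map_mul' := fun a b => by ext v; simp }
    have hpow : ∀ m i (v : P), ((((ρ' m - 1) ^ i : Module.End k P) v : P) : E) =
        ((ρ m - 1) ^ i : Module.End k E) (v : E) := by
      intro m i
      induction i with
      | zero => intro v; simp
      | succ i hi =>
        intro v
        rw [pow_succ, pow_succ, Module.End.mul_apply, Module.End.mul_apply, hi]
        rfl
    obtain ⟨v, hv, hfix⟩ := ih _ (hN ▸ Submodule.finrank_lt htop) ρ' (fun m => by
      obtain ⟨i, hi⟩ := hρ m
      refine ⟨i, LinearMap.ext fun v => Subtype.ext ?_⟩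
      rw [hpow, hi]; rfl) rfl
    exact ⟨v, fun h => hv (Subtype.ext h), fun m => congrArg Subtype.val (hfix m)⟩

end Kolchin

/-! ### Density of the points over an algebraically closed field -/

namespace SubGL

open MvPolynomial Matrix

variable {K : Type} [Field K] [IsAlgClosed K] {d : ℕ}

/-- By the Nullstellensatz, the points of a closed subscheme over an algebraically closed field
are dense in its points over any extension field. -/
theorem IsClosedSubscheme.mem_zariskiClosure {X : SubGL K d} (hX : IsClosedSubscheme X)
    {L : Type} [Field L] [Algebra K L] {g : GL (Fin d) L} (hg : g ∈ X L) :
    g ∈ zariskiClosure (X K) L := by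
  obtain ⟨S, rfl⟩ := hX
  let T : Set (CoordPoly K d) := S ∪
    {f | ∃ i j, f = (genericMatrix K d * genericInverse K d - 1) i j} ∪
    {f | ∃ i j, f = (genericInverse K d * genericMatrix K d - 1) i j}
  intro f hf
  have hmem : f ∈ (Ideal.span T).radical := by
    rw [← MvPolynomial.vanishingIdeal_zeroLocus_eq_radical (K := K), MvPolynomial.zeroLocus_span]
    intro x hx
    have hmat : ∀ M : Matrix (Fin d) (Fin d) (CoordPoly K d), (∀ i j, (M - 1) i j ∈ T) →
        M.map (aeval x : CoordPoly K d →ₐ[K] K) = 1 := by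
      intro M hM
      have h0 : (M - 1).map (aeval x : CoordPoly K d →ₐ[K] K) = 0 :=
        Matrix.ext fun i j => hx _ (hM i j)
      rwa [Matrix.map_sub _ (map_sub _), Matrix.map_one _ (map_zero _) (map_one _),
        sub_eq_zero] at h0
    let y : GL (Fin d) K :=
      { val := (genericMatrix K d).map (aeval x : CoordPoly K d →ₐ[K] K)
        inv := (genericInverse K d).map (aeval x : CoordPoly K d →ₐ[K] K)
        val_inv := by
          rw [← Matrix.map_mul]
          exact hmat _ fun i j => Or.inl (Or.inr ⟨i, j, rfl⟩)
        inv_val := by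
          rw [← Matrix.map_mul]
          exact hmat _ fun i j => Or.inr ⟨i, j, rfl⟩ }
    have hy : coords y = x := by
      funext ⟨b, i, j⟩
      cases b
      · exact aeval_X x (false, i, j)
      · exact aeval_X x (true, i, j)
    rw [← hy]
    refine hf y fun p hp => ?_
    rw [regEval_eq, evalHom, hy]
    exact hx p (Or.inl (Or.inl hp))
  have hT : Ideal.span T ≤ RingHom.ker (evalHom g : CoordPoly K d →ₐ[K] L) := by
    rw [Ideal.span_le]
    rintro p ((hp | ⟨i, j, rfl⟩) | ⟨i, j, rfl⟩)
    · exact hg p hp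
    · have : (genericMatrix K d * genericInverse K d - 1).map (evalHom g) = 0 := by
        rw [Matrix.map_sub _ (map_sub _), Matrix.map_one _ (map_zero _) (map_one _),
          Matrix.map_mul, map_genericMatrix, map_genericInverse, Units.mul_inv, sub_self]
      exact congrFun (congrFun this i) j
    · have : (genericInverse K d * genericMatrix K d - 1).map (evalHom g) = 0 := by
        rw [Matrix.map_sub _ (map_sub _), Matrix.map_one _ (map_zero _) (map_one _),
          Matrix.map_mul, map_genericMatrix, map_genericInverse, Units.inv_mul, sub_self]
      exact congrFun (congrFun this i) j
  obtain ⟨N, hN⟩ := hmem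
  have := hT hN
  rw [RingHom.mem_ker, map_pow] at this
  exact eq_zero_of_pow_eq_zero this

end SubGL

/-! ### The Weil operator and reductivity of centralizers -/

/-- Base change from `ℚ` only restricts the functor, as a ring has at most one structure of a
`ℚ`-algebra. -/
theorem SubGL.baseChange_apply {d : ℕ} (X : SubGL ℚ d) (k R : Type) [Field k] [Algebra ℚ k]
    [CommRing R] [Algebra k R] [Algebra ℚ R] : X.baseChange k R = X R :=
  congrArg (fun a => @X R _ a) (Subsingleton.elim _ _)

namespace PolarizedHodge

open SubGL Matrix

variable {d : ℕ} {n : ℤ} (V : PolarizedHodge d n) {D : Subalgebra ℚ (Matrix (Fin d) (Fin d) ℚ)}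

/-- The bilinear form `ψ_ℂ`. -/
noncomputable def complexForm : LinearMap.BilinForm ℂ (Fin d → ℂ) :=
  Matrix.toBilin' (V.psi.map (algebraMap ℚ ℂ))

theorem complexForm_apply (v w : Fin d → ℂ) : V.complexForm v w = formOn V.psi ℂ v w :=
  Matrix.toBilin'_apply' _ _ _

theorem complexForm_iso {g : GL (Fin d) ℂ} (hg : g ∈ V.iso ℂ) (v w : Fin d → ℂ) :
    V.complexForm ((g : Matrix (Fin d) (Fin d) ℂ) *ᵥ v) ((g : Matrix (Fin d) (Fin d) ℂ) *ᵥ w) =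
      V.complexForm v w := by
  simp only [complexForm_apply]
  exact hg v w

/-- The Weil operator, which acts on `V^{p,q}` as `i ^ (p - q)`, lies in the centralizer of `D`. -/
theorem exists_weil (hD : V.Preserves D) : ∃ w : GL (Fin d) ℂ, w ∈ V.centralizer D ℂ ∧
    ∀ p, ∀ v ∈ V.hdg p, (w : Matrix (Fin d) (Fin d) ℂ) *ᵥ v = Complex.I ^ (2 * p - n) • v := by
  obtain ⟨w, hw⟩ := V.exists_gl_hdg fun p => (Units.mk0 Complex.I Complex.I_ne_zero) ^ (2 * p - n)
  simp only [Units.val_zpow_eq_zpow_val, Units.val_mk0] at hw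
  refine ⟨w, ⟨fun x y => ?_, fun β hβ => V.eq_of_mulVec_hdg fun p v hv => ?_⟩, hw⟩
  · simp only [← complexForm_apply]
    induction x using V.hdg_induction with
    | h0 => simp
    | hadd a b ha hb => simp only [Matrix.mulVec_add, map_add, LinearMap.add_apply, ha, hb]
    | h p x hx =>
      induction y using V.hdg_induction with
      | h0 => simp
      | hadd a b ha hb => simp only [Matrix.mulVec_add, map_add, ha, hb]
      | h p' y hy =>
        rw [hw p x hx, hw p' y hy, map_smul, map_smul, LinearMap.smul_apply, smul_smul]
        by_cases hpp : p + p' = n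
        · rw [← zpow_add₀ Complex.I_ne_zero,
            show 2 * p' - n + (2 * p - n) = 0 by omega, zpow_zero, one_smul]
        · rw [complexForm_apply, V.orthogonal p p' hpp x hx y hy, smul_zero]
  · rw [← Matrix.mulVec_mulVec, ← Matrix.mulVec_mulVec, hw p v hv, Matrix.mulVec_smul,
      hw p _ (hD β hβ p v hv)]

/-- The hermitian form `ψ(w v, v̄)`, where `w` is the Weil operator, is definite. -/
theorem complexForm_weil_ne_zero {w : GL (Fin d) ℂ}
    (hw : ∀ p, ∀ v ∈ V.hdg p,
      (w : Matrix (Fin d) (Fin d) ℂ) *ᵥ v = Complex.I ^ (2 * p - n) • v)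
    {v : Fin d → ℂ} (hv : v ≠ 0) :
    V.complexForm ((w : Matrix (Fin d) (Fin d) ℂ) *ᵥ v) (star v) ≠ 0 := by
  classical
  obtain ⟨s, hs⟩ := V.definite
  obtain ⟨x, hx⟩ := V.isInternal.surjective v
  have hx : v = ∑ p ∈ x.support, (x p : Fin d → ℂ) := by
    rw [← hx]
    exact DirectSum.coeLinearMap_eq_dfinsuppSum V.hdg x
  have hterm : ∀ p p', V.complexForm ((w : Matrix (Fin d) (Fin d) ℂ) *ᵥ (x p : Fin d → ℂ))
      (star (x p' : Fin d → ℂ)) = if p = p' then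
        Complex.I ^ (2 * p - n) * formOn V.psi ℂ (x p) (star (x p : Fin d → ℂ)) else 0 := by
    intro p p'
    rw [hw p _ (x p).2, map_smul, LinearMap.smul_apply, complexForm_apply, smul_eq_mul]
    split_ifs with h
    · rw [h]
    · rw [V.orthogonal p (n - p') (by omega) _ (x p).2 _ (V.conj_mem p' _ (x p').2), mul_zero]
  have hsum : V.complexForm ((w : Matrix (Fin d) (Fin d) ℂ) *ᵥ v) (star v) =
      ∑ p ∈ x.support, Complex.I ^ (2 * p - n) *
        formOn V.psi ℂ (x p) (star (x p : Fin d → ℂ)) := by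
    conv_lhs => rw [hx]
    rw [Matrix.mulVec_sum, star_sum, map_sum V.complexForm, LinearMap.sum_apply]
    refine Finset.sum_congr rfl fun p hp => ?_
    rw [map_sum]
    simp_rw [hterm]
    rw [Finset.sum_ite_eq, if_pos hp]
  intro h0
  have hne : x.support.Nonempty := by
    rw [Finset.nonempty_iff_ne_empty]
    intro h
    rw [h, Finset.sum_empty] at hx
    exact hv hx
  have hpos : 0 < ∑ p ∈ x.support, ((s : ℤ) : ℝ) * (Complex.I ^ (2 * p - n) *
      formOn V.psi ℂ (x p) (star (x p : Fin d → ℂ))).re :=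
    Finset.sum_pos (fun p hp => hs p _ (x p).2 fun h =>
      DFinsupp.mem_support_iff.1 hp (Subtype.ext h)) hne
  rw [← Finset.mul_sum, ← Complex.re_sum, ← hsum, h0, Complex.zero_re, mul_zero] at hpos
  exact lt_irrefl _ hpos

/-- A unipotent subgroup `U` of the points of `C_D(Iso)` over an algebraically closed subfield of
`ℂ`, normalized by these points, is trivial. The fixed space of `U` is stable under the complex
points of `C_D(Iso)`; as these are stable under taking adjoints for the hermitian form of the Weil
operator, the orthogonal complement is stable as well, so by Kolchin's theorem it is zero. -/
theorem eq_one_of_unipotent_of_normal (hD : V.Preserves D) {K : Type} [Field K] [IsAlgClosed K]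
    [Algebra ℚ K] [Algebra K ℂ] (U : Subgroup (GL (Fin d) K))
    (hU : (U : Set (GL (Fin d) K)) ⊆ V.centralizer D K)
    (hnormal : ∀ g ∈ V.centralizer D K, ∀ u ∈ U, g * u * g⁻¹ ∈ U)
    (hunip : ∀ u ∈ U, IsNilpotent ((u : Matrix (Fin d) (Fin d) K) - 1))
    {u : GL (Fin d) K} (hu : u ∈ U) : u = 1 := by
  have hA : V.centralizer D = V.twistedCentralizer D 1 := (V.twistedCentralizer_one D).symm
  have hAcl : IsClosedSubscheme (V.centralizer D) := by
    rw [hA]; exact V.isClosedSubscheme_twistedCentralizer D 1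
  have hinv : ∀ {R : Type} [CommRing R] [Algebra ℚ R] {g : GL (Fin d) R},
      g ∈ V.centralizer D R → g⁻¹ ∈ V.centralizer D R := by
    intro R _ _ g hg
    rw [hA] at hg ⊢
    simpa using V.inv_mem_twistedCentralizer hg
  have hmul : ∀ {R : Type} [CommRing R] [Algebra ℚ R] {g h : GL (Fin d) R},
      g ∈ V.centralizer D R → h ∈ V.centralizer D R → g * h ∈ V.centralizer D R := by
    intro R _ _ g h hg hh
    rw [hA] at hg hh ⊢
    simpa using V.mul_mem_twistedCentralizer hg hh
  let ι : GL (Fin d) K →* GL (Fin d) ℂ := GeneralLinearGroup.map (algebraMap K ℂ)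
  have hUC : ∀ u ∈ U, ι u ∈ V.centralizer D ℂ := fun u hu =>
    hAcl.map_mem (algebraMap K ℂ) (Subsingleton.elim _ _) (hU hu)
  let W : Submodule ℂ (Fin d → ℂ) :=
    { carrier := {x | ∀ u ∈ U, (ι u : Matrix (Fin d) (Fin d) ℂ) *ᵥ x = x}
      zero_mem' := fun u _ => Matrix.mulVec_zero _
      add_mem' := fun {x y} hx hy u hu => by rw [Matrix.mulVec_add, hx u hu, hy u hu]
      smul_mem' := fun c x hx u hu => by rw [Matrix.mulVec_smul, hx u hu] }
  have hWA : ∀ g ∈ V.centralizer D ℂ, ∀ x ∈ W, (g : Matrix (Fin d) (Fin d) ℂ) *ᵥ x ∈ W := by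
    intro g hg x hx u hu
    have hgcl : g ∈ zariskiClosure ((V.centralizer D).baseChange K K) ℂ := by
      refine (hAcl.baseChange K).mem_zariskiClosure (L := ℂ) ?_
      rwa [baseChange_apply]
    rw [← sub_eq_zero]
    ext i
    refine eq_zero_of_mem_zariskiClosure hgcl (F := fun g => ((ι u : Matrix (Fin d) (Fin d) ℂ) *ᵥ
      ((g : Matrix (Fin d) (Fin d) ℂ) *ᵥ x) - (g : Matrix (Fin d) (Fin d) ℂ) *ᵥ x) i) ?_ ?_
    · exact sub_mem (mulVec_mulVec_mem_regularFunctions _ x i) (mulVec_mem_regularFunctions x i)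
    · intro s hs
      rw [baseChange_apply] at hs
      have h1 := hx _ (hnormal _ (hinv hs) u hu)
      have h2 : ι u * ι s = ι s * ι (s⁻¹ * u * s⁻¹⁻¹) := by
        rw [← map_mul, ← map_mul]
        group
      have h3 : (ι u : Matrix (Fin d) (Fin d) ℂ) *ᵥ ((ι s : Matrix (Fin d) (Fin d) ℂ) *ᵥ x) =
          (ι s : Matrix (Fin d) (Fin d) ℂ) *ᵥ x := by
        rw [Matrix.mulVec_mulVec, ← Units.val_mul, h2, Units.val_mul, ← Matrix.mulVec_mulVec, h1]
      exact congrFun (sub_eq_zero.2 h3) i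
  obtain ⟨w, hwA, hw⟩ := V.exists_weil hD
  let P : Submodule ℂ (Fin d → ℂ) :=
    { carrier := {y | ∀ x ∈ W, V.complexForm ((w : Matrix (Fin d) (Fin d) ℂ) *ᵥ x) (star y) = 0}
      zero_mem' := fun x _ => by rw [star_zero, map_zero]
      add_mem' := fun {y z} hy hz x hx => by rw [star_add, map_add, hy x hx, hz x hx, add_zero]
      smul_mem' := fun c y hy x hx => by rw [star_smul, map_smul, hy x hx, smul_zero] }
  have hPA : ∀ g ∈ V.centralizer D ℂ, ∀ y ∈ P, (g : Matrix (Fin d) (Fin d) ℂ) *ᵥ y ∈ P := by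
    intro g hg y hy x hx
    let g' := GeneralLinearGroup.map (starRingEnd ℂ) g
    have hg' : g' ∈ V.centralizer D ℂ :=
      hAcl.map_mem (starRingEnd ℂ) (Subsingleton.elim _ _) hg
    have h1 := hy _ (hWA _ (hmul (hmul (hinv hwA) (hinv hg')) hwA) x hx)
    have h2 : (w : Matrix (Fin d) (Fin d) ℂ) *ᵥ x = (g' : Matrix (Fin d) (Fin d) ℂ) *ᵥ
        ((w : Matrix (Fin d) (Fin d) ℂ) *ᵥ
          (((w⁻¹ * g'⁻¹ * w : GL (Fin d) ℂ) : Matrix (Fin d) (Fin d) ℂ) *ᵥ x)) := by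
      simp only [Matrix.mulVec_mulVec, ← Units.val_mul]
      congr 2
      group
    rw [← map_star_mulVec, h2]
    exact (V.complexForm_iso hg'.1 _ _).trans h1
  have hWP : ∀ y ∈ W, y ∈ P → y = 0 := fun y hyW hyP => by
    by_contra hy
    exact V.complexForm_weil_ne_zero hw hy (hyP y hyW)
  have hP : P = ⊥ := by
    by_contra hP
    have : Nontrivial P := Submodule.nontrivial_iff_ne_bot.2 hP
    let ρ : U →* Module.End ℂ P :=
      { toFun := fun u => (Matrix.toLin' (ι u : Matrix (Fin d) (Fin d) ℂ)).restrict
          fun y hy => hPA _ (hUC u u.2) y hy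
        map_one' := by ext y; simp
        map_mul' := fun a b => LinearMap.ext fun y => Subtype.ext (by
          change ((ι (a * b : U) : GL (Fin d) ℂ) : Matrix (Fin d) (Fin d) ℂ) *ᵥ (y : Fin d → ℂ) =
            (ι a : Matrix (Fin d) (Fin d) ℂ) *ᵥ ((ι b : Matrix (Fin d) (Fin d) ℂ) *ᵥ y)
          rw [Matrix.mulVec_mulVec, ← Units.val_mul, ← map_mul]
          rfl) }
    have hpow : ∀ (u : U) (i : ℕ) (y : P), ((((ρ u - 1) ^ i : Module.End ℂ P) y : P) : Fin d → ℂ) =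
        ((ι u : Matrix (Fin d) (Fin d) ℂ) - 1) ^ i *ᵥ (y : Fin d → ℂ) := by
      intro u i
      induction i with
      | zero => intro y; simp
      | succ i hi =>
        intro y
        rw [pow_succ, pow_succ, Module.End.mul_apply, hi, ← Matrix.mulVec_mulVec,
          Matrix.sub_mulVec, Matrix.one_mulVec]
        rfl
    obtain ⟨y, hy0, hy⟩ := ρ.exists_fixed_of_unipotent fun u => by
      obtain ⟨N, hN⟩ := hunip u u.2
      refine ⟨N, LinearMap.ext fun y => Subtype.ext ?_⟩
      have h1 : (ι u : Matrix (Fin d) (Fin d) ℂ) - 1 =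
          (algebraMap K ℂ).mapMatrix ((u : GL (Fin d) K) - 1 : Matrix (Fin d) (Fin d) K) := by
        rw [map_sub, map_one]
        rfl
      rw [hpow, h1, ← map_pow, hN, map_zero, Matrix.zero_mulVec]
      rfl
    refine hy0 (Subtype.ext (hWP y (fun u hu => ?_) y.2))
    exact congrArg Subtype.val (hy ⟨u, hu⟩)
  have hW : W = ⊤ := by
    by_contra hW
    let φ : (Fin d → ℂ) →ₗ[ℂ] Module.Dual ℂ W :=
      ((V.complexForm ∘ₗ (Matrix.toLin' (w : Matrix (Fin d) (Fin d) ℂ))) ∘ₗ W.subtype).flip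
    obtain ⟨y, hy, hy0⟩ := (Submodule.ne_bot_iff _).1 (LinearMap.ker_ne_bot_of_finrank_lt (f := φ)
      (by rw [Subspace.dual_finrank_eq]; exact Submodule.finrank_lt hW))
    refine hy0 ?_
    have : star y ∈ P := fun x hx => by
      rw [star_star]
      exact DFunLike.congr_fun (LinearMap.mem_ker.1 hy) (⟨x, hx⟩ : W)
    rw [hP, Submodule.mem_bot, star_eq_zero] at this
    exact this
  have hι : ι u = 1 := by
    refine Units.ext (Matrix.mulVec_injective (funext fun x => ?_))
    rw [Units.val_one, Matrix.one_mulVec]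
    exact (hW ▸ Submodule.mem_top : x ∈ W) u hu
  have hinj : Function.Injective ι := fun a b hab =>
    Units.ext (Matrix.map_injective (algebraMap K ℂ).injective (congrArg Units.val hab))
  exact hinj (hι.trans (map_one ι).symm)

end PolarizedHodge

/-! ### Reductivity of the twisted Lefschetz groups -/

namespace PolarizedHodge

open SubGL Matrix

variable {F Fbar : Type*} [Field F] [Field Fbar] [Algebra F Fbar] {d : ℕ} {n : ℤ}
  (V : PolarizedHodge d n) {D : Subalgebra ℚ (Matrix (Fin d) (Fin d) ℚ)}
  (ρe : (Fbar ≃ₐ[F] Fbar) →* (D ≃ₐ[ℚ] D)) (K : IntermediateField F Fbar)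

theorem centralizer_contained_twistedLefschetz :
    Contained (V.centralizer D) (V.twistedLefschetz ρe K) := by
  intro R _ _ g hg
  rw [← twistedCentralizer_one] at hg
  refine mem_union_of_mem (fun σ : K.fixingSubgroup => V.twistedCentralizer D (ρe σ)) 1 ?_
  simpa using hg

/-- If `C_D(Iso)` is connected, it is the identity component of the twisted Lefschetz group, in
which it is open and closed. -/
theorem idComp_twistedLefschetz [Finite (K.fixingSubgroup.map ρe)]
    (hconn : V.lefschetz D = V.centralizer D) :
    idComp (V.twistedLefschetz ρe K) = V.centralizer D := by
  obtain ⟨e, -, he⟩ := V.exists_separates_twistedCentralizer ρe K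
  funext R _ _
  ext g
  constructor
  · rintro ⟨hg, h⟩
    rw [twistedLefschetz_eq_union] at hg h
    have hidem : ∀ (A : Type) [CommRing A] [Algebra ℚ A],
        ∀ x ∈ union (fun a : K.fixingSubgroup.map ρe => V.twistedCentralizer D a) A,
          IsIdempotentElem (regEval x (e 1)) := by
      intro A _ _ x hx
      have := hx (e 1 * e 1 - e 1) fun a B _ _ y hy => by
        rw [regEval_eq, map_sub, map_mul, ← regEval_eq]
        by_cases ha : 1 = a
        · subst ha
          rw [he.eq_one 1 B y hy, mul_one, sub_self]
        · rw [he.eq_zero 1 a ha B y hy, mul_zero, sub_self]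
      rwa [regEval_eq, map_sub, map_mul, sub_eq_zero] at this
    have h1 := h (e 1) hidem (he.eq_one 1 ℚ 1 (V.one_mem_twistedCentralizer D))
    rw [← twistedCentralizer_one, (V.isClosedSubscheme_twistedCentralizer D 1).mem_iff]
    intro f hf
    have := ((V.isClosedSubscheme_twistedCentralizer D 1).restrictTo_mem_iff _ g).1
      (he.restrictTo_mem 1 (V.isClosedSubscheme_twistedCentralizer D 1) hg) f hf
    rwa [h1, one_mul] at this
  · intro hg
    refine ⟨V.centralizer_contained_twistedLefschetz ρe K R hg, fun e he h1 => ?_⟩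
    rw [← hconn] at hg
    exact hg.2 e (fun A _ _ x hx =>
      he A x (V.centralizer_contained_twistedLefschetz ρe K A hx)) h1

theorem nonempty_algebraicClosure_ringHom (k : Type*) [Field k] [Algebra k ℂ] :
    Nonempty (AlgebraicClosure k →+* ℂ) :=
  ⟨(IsAlgClosed.lift (R := k) (S := AlgebraicClosure k) (M := ℂ)).toRingHom⟩

/-- If `C_D(Iso)` is connected, the twisted Lefschetz group is reductive. -/
theorem isReductive_twistedLefschetz [Finite (K.fixingSubgroup.map ρe)] (hD : V.Preserves D)
    (hconn : V.lefschetz D = V.centralizer D) : IsReductive (V.twistedLefschetz ρe K) := by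
  intro U hU _ _ hnormal hunip
  rw [V.idComp_twistedLefschetz ρe K hconn] at hU hnormal
  obtain ⟨φ⟩ := nonempty_algebraicClosure_ringHom ℚ
  let _ : Algebra (AlgebraicClosure ℚ) ℂ := φ.toAlgebra
  rw [Subgroup.eq_bot_iff_forall]
  exact fun u hu => V.eq_one_of_unipotent_of_normal hD U hU hnormal hunip hu

/-! ### Comparison of the Galois and the Lefschetz side -/

/-- Only the trivial twist occurs over `K_e`, since `G_{K_e} = G_K ∩ ker ρ_e` by infinite Galois
theory. -/
theorem twistedLefschetz_fieldKe [IsGalois F Fbar]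
    (hρe : IsOpen (ρe.ker : Set (Fbar ≃ₐ[F] Fbar))) (hK : FiniteDimensional F K) :
    V.twistedLefschetz ρe (fieldKe ρe K) = V.centralizer D := by
  have hopen : IsOpen ((K.fixingSubgroup ⊓ ρe.ker : Subgroup (Fbar ≃ₐ[F] Fbar)) :
      Set (Fbar ≃ₐ[F] Fbar)) := K.fixingSubgroup_isOpen.inter hρe
  have hfix : (fieldKe ρe K).fixingSubgroup = K.fixingSubgroup ⊓ ρe.ker :=
    InfiniteGalois.fixingSubgroup_fixedField
      ⟨K.fixingSubgroup ⊓ ρe.ker, Subgroup.isClosed_of_isOpen _ hopen⟩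
  have h1 : (fun σ : (fieldKe ρe K).fixingSubgroup => V.twistedCentralizer D (ρe σ)) =
      fun _ => V.centralizer D := by
    funext σ
    have h2 : (σ : Fbar ≃ₐ[F] Fbar) ∈ K.fixingSubgroup ⊓ ρe.ker := hfix ▸ σ.2
    rw [MonoidHom.mem_ker.1 h2.2, twistedCentralizer_one]
  rw [twistedLefschetz, h1, IsClosedSubscheme.union_const]
  rw [← twistedCentralizer_one]
  exact V.isClosedSubscheme_twistedCentralizer D 1

theorem finite_map_fixingSubgroup [IsGalois F Fbar]
    (hρe : IsOpen (ρe.ker : Set (Fbar ≃ₐ[F] Fbar))) : Finite (K.fixingSubgroup.map ρe) := by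
  have := Subgroup.quotient_finite_of_isOpen ρe.ker hρe
  have : Finite ρe.range := Finite.of_equiv _ (QuotientGroup.quotientKerEquivRange ρe).toEquiv
  exact Finite.of_injective _ (Subgroup.inclusion_injective (Subgroup.map_le_range ρe _))

section Galois

variable {l : ℕ} [Fact l.Prime] {ρl : (Fbar ≃ₐ[F] Fbar) →* GL (Fin d) ℚ_[l]} {ρe}

theorem mem_conjugationLocus_of_actionEquivariant (h : ActionEquivariant ρe ρl)
    (σ : Fbar ≃ₐ[F] Fbar) : ρl σ ∈ conjugationLocus D (ρe σ) ℚ_[l] := by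
  intro β
  have h1 : (ρl σ : Matrix (Fin d) (Fin d) ℚ_[l]) *
      (β : Matrix (Fin d) (Fin d) ℚ).map (algebraMap ℚ ℚ_[l]) =
      ((ρe σ β : D) : Matrix (Fin d) (Fin d) ℚ).map (algebraMap ℚ ℚ_[l]) *
        (ρl σ : Matrix (Fin d) (Fin d) ℚ_[l]) :=
    Matrix.mulVec_injective (funext fun v => by
      rw [← Matrix.mulVec_mulVec, ← Matrix.mulVec_mulVec]
      exact h σ β v)
  rw [h1, mul_assoc, Units.mul_inv, mul_one]

theorem exists_multiplier_of_formEquivariant (h : FormEquivariant V ρl) (σ : Fbar ≃ₐ[F] Fbar) :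
    ∃ c : ℚ_[l], c ≠ 0 ∧ (ρl σ : Matrix (Fin d) (Fin d) ℚ_[l])ᵀ *
      V.psi.map (algebraMap ℚ ℚ_[l]) * (ρl σ : Matrix (Fin d) (Fin d) ℚ_[l]) =
        c • V.psi.map (algebraMap ℚ ℚ_[l]) := by
  refine ⟨((cyclotomicCharacter Fbar l (σ : Fbar ≃+* Fbar) ^ (-n) : ℤ_[l]ˣ) : ℤ_[l]), ?_,
    Matrix.ext fun i j => ?_⟩
  · exact fun h0 => Units.ne_zero _ (PadicInt.coe_eq_zero.1 h0)
  · have := h σ (Pi.single i 1) (Pi.single j 1)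
    rw [formOn, formOn, Matrix.dotProduct_mulVec, ← Matrix.vecMul_transpose, Matrix.vecMul_vecMul,
      ← Matrix.dotProduct_mulVec, Matrix.mulVec_mulVec] at this
    simpa using this

/-- The elements `ρ_l(σ)`, `σ ∈ G_K`, act on `D` through `ρ_e(σ)`, so that the closure of their
group lies in the union of the corresponding conjugation loci. -/
theorem galoisAlgOne_contained [Finite (K.fixingSubgroup.map ρe)]
    (hact : ActionEquivariant ρe ρl) :
    Contained (galoisAlgOne V ρl K) ((V.twistedLefschetz ρe K).baseChange ℚ_[l]) := by
  refine V.zariskiClosure_inter_iso_contained ρe K ?_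
  rintro _ ⟨σ, hσ, rfl⟩
  refine ⟨ρe σ, ⟨σ, hσ, rfl⟩, ?_⟩
  rw [baseChange_apply]
  exact mem_conjugationLocus_of_actionEquivariant hact σ

/-- If `G_{l,K}^alg` contains the Mumford-Tate group, and this contains `C_D(Iso)`, then every twist
of `C_D(Iso)` by an element of `G_K` lies in `G_{l,K}^alg`. -/
theorem contained_galoisAlgOne [Finite (K.fixingSubgroup.map ρe)] (hn : n ≠ 0)
    (hψ : FormEquivariant V ρl) (hact : ActionEquivariant ρe ρl)
    (hMT : Contained (V.mumfordTate.baseChange ℚ_[l]) (galoisAlg ρl K))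
    (hC : Contained (V.centralizer D) V.mumfordTate) :
    Contained ((V.twistedLefschetz ρe K).baseChange ℚ_[l]) (galoisAlgOne V ρl K) := by
  have hcl : IsClosedSubscheme (galoisAlg ρl K) := isClosedSubscheme_zeroLocus _
  rw [baseChange_twistedLefschetz]
  refine union_contained (hcl.inter (V.isClosedSubscheme_iso.baseChange _)) ?_
  rintro ⟨_, σ, hσ, rfl⟩ R _ _ g hg
  refine ⟨?_, hg.1⟩
  obtain ⟨c, hc, hσc⟩ := V.exists_multiplier_of_formEquivariant hψ σ
  refine V.twistedCentralizer_contained_zariskiClosure (K.fixingSubgroup.map ρl)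
    (fun R _ _ x hx => hMT R ?_) (fun R _ _ s => hMT R ?_) ⟨σ, hσ, rfl⟩ (a := ρe σ) ?_ hc hσc R hg
  · let _ : Algebra ℚ R := Algebra.compHom R (algebraMap ℚ ℚ_[l])
    exact hC R hx
  · let _ : Algebra ℚ R := Algebra.compHom R (algebraMap ℚ ℚ_[l])
    exact V.scalar_mem_mumfordTate hn s
  · rw [baseChange_apply]
    exact mem_conjugationLocus_of_actionEquivariant hact σ

/-- The identity component of `G_{l,K}^alg` is contained in `G_{l,K'}^alg` for every finite
extension `K'`. -/
theorem idComp_galoisAlg_contained [IsGalois F Fbar] (K' : IntermediateField F Fbar)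
    (hK' : FiniteDimensional F K') :
    Contained (idComp (galoisAlg ρl K)) (galoisAlg ρl K') := by
  refine idComp_zariskiClosure_contained (K.fixingSubgroup.map ρl) (K'.fixingSubgroup.map ρl) ?_
  rw [Subgroup.relIndex_map_map]
  have := Subgroup.quotient_finite_of_isOpen K'.fixingSubgroup K'.fixingSubgroup_isOpen
  have : K'.fixingSubgroup.FiniteIndex := Subgroup.finiteIndex_of_finite_quotient
  have : (K'.fixingSubgroup ⊔ ρl.ker).FiniteIndex := Subgroup.finiteIndex_of_le le_sup_left
  exact Subgroup.FiniteIndex.index_ne_zero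
    (H := (K'.fixingSubgroup ⊔ ρl.ker).subgroupOf (K.fixingSubgroup ⊔ ρl.ker))

end Galois

end PolarizedHodge

theorem mainTheorem10 {F Fbar : Type*} [Field F] [NumberField F] [Field Fbar] [Algebra F Fbar]
    [IsAlgClosure F Fbar] {d : ℕ} {n : ℤ} (hn : Odd n) (V : PolarizedHodge d n)
    (D : Subalgebra ℚ (Matrix (Fin d) (Fin d) ℚ)) (hD : V.Preserves D)
    (ρe : (Fbar ≃ₐ[F] Fbar) →* (D ≃ₐ[ℚ] D))
    (hρe : IsOpen (ρe.ker : Set (Fbar ≃ₐ[F] Fbar)))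
    (ρ : ∀ (l : ℕ) [Fact l.Prime], (Fbar ≃ₐ[F] Fbar) →* GL (Fin d) ℚ_[l])
    (hρ : ∀ (l : ℕ) [Fact l.Prime], Continuous (ρ l))
    (hψ : ∀ (l : ℕ) [Fact l.Prime], FormEquivariant V (ρ l))
    (hact : ∀ (l : ℕ) [Fact l.Prime], ActionEquivariant ρe (ρ l))
    (K : IntermediateField F Fbar) (hK : FiniteDimensional F K)
    (hHL : V.hodgeGroup = V.lefschetz D)
    (hLDL : V.lefschetz D = V.twistedLefschetz ρe (PolarizedHodge.fieldKe ρe K))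
    (hMT : ∀ (l : ℕ) [Fact l.Prime],
      SubGL.idComp (galoisAlg (ρ l) K) = V.mumfordTate.baseChange ℚ_[l]) :
    (∀ (l : ℕ) [Fact l.Prime],
      galoisAlgOne V (ρ l) K = (V.twistedLefschetz ρe K).baseChange ℚ_[l]) ∧
    AlgebraicSatoTate V ρ (fun K' => V.twistedLefschetz ρe K') := by
  have hconn : V.lefschetz D = V.centralizer D :=
    hLDL.trans (V.twistedLefschetz_fieldKe ρe K hρe hK)
  have hC : SubGL.Contained (V.centralizer D) V.mumfordTate := by
    intro R _ _ g hg
    rw [← hconn, ← hHL] at hg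
    exact hg.1.1
  have hfin : ∀ K' : IntermediateField F Fbar, Finite (K'.fixingSubgroup.map ρe) :=
    fun K' => PolarizedHodge.finite_map_fixingSubgroup ρe K' hρe
  have hn0 : n ≠ 0 := by
    rintro rfl
    exact Int.not_odd_zero hn
  have key : ∀ (l : ℕ) [Fact l.Prime] (K' : IntermediateField F Fbar), FiniteDimensional F K' →
      galoisAlgOne V (ρ l) K' = (V.twistedLefschetz ρe K').baseChange ℚ_[l] := by
    intro l _ K' hK'
    have := hfin K'
    have hMT' : SubGL.Contained (V.mumfordTate.baseChange ℚ_[l]) (galoisAlg (ρ l) K') := by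
      rw [← hMT l]
      exact PolarizedHodge.idComp_galoisAlg_contained K K' hK'
    funext R _ _
    exact Set.Subset.antisymm (V.galoisAlgOne_contained K' (hact l) R)
      (V.contained_galoisAlgOne K' hn0 (hψ l) (hact l) hMT' hC R)
  refine ⟨fun l _ => key l K hK, ?_⟩
  constructor
  · intro K' _
    have := hfin K'
    exact V.isAlgSubgroup_twistedLefschetz ρe K'
  · exact fun K' _ => V.twistedLefschetz_contained_iso ρe K'
  · intro K' _
    have := hfin K'
    exact V.isReductive_twistedLefschetz ρe K' hD hconn
  · intro K₁ K₂ _ _ hle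
    exact SubGL.union_contained (SubGL.isClosedSubscheme_zeroLocus _) fun σ _ _ _ _ hg =>
      SubGL.mem_union_of_mem
        (fun σ : K₁.fixingSubgroup => V.twistedCentralizer D (ρe σ))
        ⟨σ, IntermediateField.fixingSubgroup_le hle σ.2⟩ hg
  · intro l _
    refine ⟨fun _ _ _ _ g => g, fun K' hK' => ?_, fun _ _ _ _ _ _ _ _ _ _ => rfl⟩
    rw [key l K' hK']
    exact ⟨fun _ _ _ => Set.bijOn_id _, fun _ _ _ _ _ _ _ => rfl, fun _ _ _ _ _ _ _ _ _ => rfl⟩
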